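/- Let $q\ge p$ and consider the linear system $$Y_k(s)=G_1(s)U_k(s)+G_2(s)D(s),\qquad k=0,1,2,\dots,$$ where $G_1$ ($q\times p$) and $G_2$ ($q\times m$) are matrices of real rational functions, $U_k$, $Y_k$ are the Laplace transforms of the input $u_k$ and of the (continuous) output $y_k$, and the following conditions hold. (C1) $G_1$ and $G_2$ are strictly proper, i.e. $G_i(s)\to 0$ as $s\to\infty$. (C2) $D(s)=d_0+\widehat D(s)$ with a nonzero vector $d_0\in\mathbb R^m$ and a strictly proper vector $\widehat D$ of real rational functions. (C3) $G_1$ has relative degree one, i.e. $G_1(s)\to0$ and $sG_1(s)$ converges, as $s\to\infty$, to a real matrix of full rank. Signals live on a time horizon $J=[0,T]$ with $0<T<\infty$, or $J=[0,\infty)$. A function on $J$ enters an equation between Laplace transforms through a prolongation of it to $[0,\infty)$ that has an (absolutely convergent) Laplace transform; for $J=[0,\infty)$ this is the function itself. Equations between transforms are meant for all $s$ with sufficiently large real part. Let $y_d\in C^1(J;\mathbb R^q)$; if $J=[0,\infty)$, assume that $\dot y_d$ has a Laplace transform. Call $y_d$ trackable if, for some prolongation with transform $Y_d$, there is an input $u_d$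 on $[0,\infty)$ with a Laplace transform $U_d$ such that $$G_1(s)U_d(s)=Y_d(s)-G_2(s)D(s).\qquad(1)$$ Then $G_1^{\mathsf T}G_1$ is nonsingular as a matrix of rational functions, and $y_d$ is trackable if and only if * $y_d(0)=y_k(0)$ for all $k\ge 0$, and * the transform $Y_d$ of some prolongation of $y_d$ satisfies $\{I-G_1(s)[G_1^{\mathsf T}(s)G_1(s)]^{-1}G_1^{\mathsf T}(s)\}[Y_d(s)-G_2(s)D(s)]=0$. Further, if $y_d$ is trackable, there is a continuous $u_d:J\to\mathbb R^p$ such that (1) holds for some prolongations of $y_d$ and $u_d$, and whenever (1) holds for the transform $Y_d$ of a prolongation of $y_d$ and the transform $U_d$ of an input, then $$U_d(s)=[G_1^{\mathsf T}(s)G_1(s)]^{-1}G_1^{\mathsf T}(s)[Y_d(s)-G_2(s)D(s)],$$ and that input equals $u_d$ almost everywhere on $J$. In particular the desired input is unique and continuous. -/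

import Mathlib

open Filter Topology MeasureTheory Matrix Set

namespace ILC

noncomputable section

/-- The value at the complex frequency `s` of a rational function with real coefficients.
(Meaningful away from the finitely many poles; below it is used only for large `s`.) -/
def evalAt (s : ℂ) (g : RatFunc ℝ) : ℂ := g.eval (algebraMap ℝ ℂ) s

/-- The complex vector obtained by evaluating a rational vector at `s`. -/
def evalVec {n : ℕ} (s : ℂ) (v : Fin n → RatFunc ℝ) : Fin n → ℂ := fun i => evalAt s (v i)

/-- The complex matrix obtained by evaluating a rational matrix at `s`. -/
def evalMat {a b : ℕ} (s : ℂ) (G : Matrix (Fin a) (Fin b) (RatFunc ℝ)) :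
    Matrix (Fin a) (Fin b) ℂ := G.map (evalAt s)

/-- A rational function `g` is strictly proper if `g(s) → 0` as `s → ∞`. A rational vector or
matrix is strictly proper if all its entries are. -/
def StrictlyProper (g : RatFunc ℝ) : Prop :=
  Tendsto (fun s : ℂ => evalAt s g) (cocompact ℂ) (𝓝 0)

/-- The transfer matrix `G` has relative degree `r`: `s ^ j G(s) → 0` as `s → ∞` for all `j < r`,
while `s ^ r G(s)` converges to a real matrix of full rank. (For a realization
`G(s) = C (sI - A)⁻¹ B` and `r ≥ 1` this says that `C A ^ j B = 0` for `j + 1 < r` and that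
`C A ^ (r - 1) B` has full rank.) -/
def HasRelativeDegree {a b : ℕ} (G : Matrix (Fin a) (Fin b) (RatFunc ℝ)) (r : ℕ) : Prop :=
  (∀ j < r, Tendsto (fun s : ℂ => s ^ j • evalMat s G) (cocompact ℂ) (𝓝 0)) ∧
  ∃ M : Matrix (Fin a) (Fin b) ℝ,
    Tendsto (fun s : ℂ => s ^ r • evalMat s G) (cocompact ℂ) (𝓝 (M.map (algebraMap ℝ ℂ))) ∧
    M.rank = min a b

/-- The signal `f : [0, ∞) → ℝⁿ` has a Laplace transform: `e ^ (-σ t) f(t)` is integrable on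
`(0, ∞)` for some real `σ`. -/
def LaplaceTransformable {n : ℕ} (f : ℝ → Fin n → ℝ) : Prop :=
  ∃ σ : ℝ, IntegrableOn (fun t => Real.exp (-σ * t) • f t) (Ioi 0)

/-- The (one-sided) Laplace transform of `f` at `s`. -/
def laplace {n : ℕ} (f : ℝ → Fin n → ℝ) (s : ℂ) : Fin n → ℂ :=
  fun i => ∫ t in Ioi (0 : ℝ), Complex.exp (-s * t) * (f t i : ℂ)

/-- The filter of right half-planes: equations between Laplace transforms and rational functions
are equations valid for all `s` with sufficiently large real part. -/
def rightHalfPlanes : Filter ℂ := comap Complex.re atTop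

/-- A signal `f` on the time horizon `J` (either `[0, T]` or `[0, ∞)`) enters frequency-domain
equations through a prolongation `F` of it to `[0, ∞)` that has a Laplace transform.
For `J = [0, ∞)` this is `f` itself. -/
def IsProlongation {n : ℕ} (J : Set ℝ) (f F : ℝ → Fin n → ℝ) : Prop :=
  LaplaceTransformable F ∧ EqOn F f J

section System

variable {q p m : ℕ} (G₁ : Matrix (Fin q) (Fin p) (RatFunc ℝ))
  (G₂ : Matrix (Fin q) (Fin m) (RatFunc ℝ)) (D : Fin m → RatFunc ℝ) (J : Set ℝ)

/-- On the horizon `J`, `y` is an output of the system `Y = G₁ U + G₂ D` under the input `u`. -/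
def IsOutput (u : ℝ → Fin p → ℝ) (y : ℝ → Fin q → ℝ) : Prop :=
  ∃ U Y, IsProlongation J u U ∧ IsProlongation J y Y ∧
    (fun s => laplace Y s) =ᶠ[rightHalfPlanes]
      fun s => evalMat s G₁ *ᵥ laplace U s + evalVec s (G₂ *ᵥ D)

/-- The algebraic equation `G₁ U = Y - G₂ D` for the Laplace transforms of two signals `u`, `y`
on `[0, ∞)`. -/
def SolvesTrackingEq (u : ℝ → Fin p → ℝ) (y : ℝ → Fin q → ℝ) : Prop :=
  (fun s => evalMat s G₁ *ᵥ laplace u s) =ᶠ[rightHalfPlanes]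
    fun s => laplace y s - evalVec s (G₂ *ᵥ D)

/-- The trajectory `yd` on `J` is trackable: some input solves the algebraic equation
`G₁ U_d = Y_d - G₂ D`. -/
def Trackable (yd : ℝ → Fin q → ℝ) : Prop :=
  ∃ Y u, IsProlongation J yd Y ∧ LaplaceTransformable u ∧ SolvesTrackingEq G₁ G₂ D u Y

/-- The projection equation `{I - G₁ (G₁ᵀ G₁)⁻¹ G₁ᵀ} [Y - G₂ D] = 0` for a signal `y` on `[0, ∞)`;
the inverse is that of a matrix over the field of rational functions. -/
def ProjectionEq (y : ℝ → Fin q → ℝ) : Prop :=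
  (fun s => evalMat s (1 - G₁ * (G₁ᵀ * G₁)⁻¹ * G₁ᵀ) *ᵥ (laplace y s - evalVec s (G₂ *ᵥ D)))
    =ᶠ[rightHalfPlanes] fun _ => 0

/-- The input formula `U = (G₁ᵀ G₁)⁻¹ G₁ᵀ [Y - G₂ D]`. -/
def InputFormula (u : ℝ → Fin p → ℝ) (y : ℝ → Fin q → ℝ) : Prop :=
  (fun s => laplace u s) =ᶠ[rightHalfPlanes]
    fun s => evalMat s ((G₁ᵀ * G₁)⁻¹ * G₁ᵀ) *ᵥ (laplace y s - evalVec s (G₂ *ᵥ D))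

end System

end

end ILC

namespace ILC

noncomputable section

/-! Write `G₂ D` as the transform of a signal `w = w₀ + ∫ω` with `ω` continuous
(`exists_signal_of_strictlyProper`). Since `s G₁(s)` tends to a real matrix of full column rank,
`(G₁ᵀG₁)⁻¹G₁ᵀ = s H` with `H` proper, and the projection `G₁ s H` is proper too
(`HasRelativeDegree.leftInverse`). A proper matrix acts on signals as a constant matrix plus
convolution with a continuous kernel (`causalOp`), hence causally.

Necessity: `G₁` is strictly proper, so the response to any transformable input is continuous and
vanishes at time 0. Every continuous output, and every trackable `yd`, therefore starts at `w 0`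
(`IsHorizon.output_zero_eq`). Multiplying (1) by the left inverse gives the input formula and the
projection equation.

Sufficiency: if `yd 0 = w 0`, then `yd - w = ∫v` on `J` with `v = yd' - ω`, so the factor `s` in `s
H (Y - W)` is absorbed by differentiation and the input is `H` applied to `v`, continuous on `J`.
Only the values on `J` are prescribed, so causality is used to see that a suitable prolongation of
`yd` exists (`IsHorizon.exists_prolongation_causalOp`).

Uniqueness: the primitive of any solution agrees on `J` with the primitive of this input, again by
causality; differentiate (`IsHorizon.ae_eq_causalOp`). -/

/-! ### Evaluation of rational functions and matrices near infinity. -/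

/-- `RatFunc.eval` respects sums and products only away from poles. These are finitely many, so
algebraic identities survive evaluation near infinity. -/
theorem eventually_denom_ne_zero (g : RatFunc ℝ) :
    ∀ᶠ s in cocompact ℂ, Polynomial.eval₂ (algebraMap ℝ ℂ) s g.denom ≠ 0 := by
  have hne : g.denom.map (algebraMap ℝ ℂ) ≠ 0 :=
    (Polynomial.map_ne_zero_iff (algebraMap ℝ ℂ).injective).2 g.denom_ne_zero
  have hfin : {s : ℂ | (g.denom.map (algebraMap ℝ ℂ)).IsRoot s}.Finite :=
    Polynomial.finite_setOfPred_isRoot hne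
  filter_upwards [hfin.isCompact.compl_mem_cocompact] with s hs h0
  exact hs (by simpa [Polynomial.IsRoot, Polynomial.eval_map] using h0)

theorem evalAt_add (x y : RatFunc ℝ) :
    ∀ᶠ s in cocompact ℂ, evalAt s (x + y) = evalAt s x + evalAt s y := by
  filter_upwards [eventually_denom_ne_zero x, eventually_denom_ne_zero y] with s hx hy
  exact RatFunc.eval_add _ _ hx hy

theorem evalAt_mul (x y : RatFunc ℝ) :
    ∀ᶠ s in cocompact ℂ, evalAt s (x * y) = evalAt s x * evalAt s y := by
  filter_upwards [eventually_denom_ne_zero x, eventually_denom_ne_zero y] with s hx hy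
  exact RatFunc.eval_mul _ _ hx hy

@[simp] theorem evalAt_C (s : ℂ) (c : ℝ) : evalAt s (RatFunc.C c) = c := by simp [evalAt]

@[simp] theorem evalAt_X (s : ℂ) : evalAt s RatFunc.X = s := by simp [evalAt]

@[simp] theorem evalAt_zero (s : ℂ) : evalAt s 0 = 0 := by simp [evalAt]

@[simp] theorem evalAt_one (s : ℂ) : evalAt s 1 = 1 := by simp [evalAt]

theorem evalAt_neg (x : RatFunc ℝ) :
    ∀ᶠ s in cocompact ℂ, evalAt s (-x) = -evalAt s x := by
  filter_upwards [evalAt_add x (-x)] with s h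
  rw [add_neg_cancel, evalAt_zero] at h
  exact (neg_eq_of_add_eq_zero_right h.symm).symm

theorem evalAt_sub (x y : RatFunc ℝ) :
    ∀ᶠ s in cocompact ℂ, evalAt s (x - y) = evalAt s x - evalAt s y := by
  filter_upwards [evalAt_add x (-y), evalAt_neg y] with s h h'
  rw [sub_eq_add_neg, h, h', sub_eq_add_neg]

theorem evalAt_sum {ι : Type*} (t : Finset ι) (f : ι → RatFunc ℝ) :
    ∀ᶠ s in cocompact ℂ, evalAt s (∑ i ∈ t, f i) = ∑ i ∈ t, evalAt s (f i) := by
  classical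
  induction t using Finset.induction_on with
  | empty => simp
  | insert a t ha ih =>
    filter_upwards [ih, evalAt_add (f a) (∑ i ∈ t, f i)] with s h h'
    rw [Finset.sum_insert ha, Finset.sum_insert ha, h', h]

theorem evalAt_prod {ι : Type*} (t : Finset ι) (f : ι → RatFunc ℝ) :
    ∀ᶠ s in cocompact ℂ, evalAt s (∏ i ∈ t, f i) = ∏ i ∈ t, evalAt s (f i) := by
  classical
  induction t using Finset.induction_on with
  | empty => simp
  | insert a t ha ih =>
    filter_upwards [ih, evalAt_mul (f a) (∏ i ∈ t, f i)] with s h h'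
    rw [Finset.prod_insert ha, Finset.prod_insert ha, h', h]

theorem evalAt_intCast (s : ℂ) (n : ℤ) : evalAt s (n : RatFunc ℝ) = n := by
  have : (n : RatFunc ℝ) = RatFunc.C (n : ℝ) := by simp
  rw [this, evalAt_C]; simp

theorem evalMat_mul {a b c : ℕ} (A : Matrix (Fin a) (Fin b) (RatFunc ℝ))
    (B : Matrix (Fin b) (Fin c) (RatFunc ℝ)) :
    ∀ᶠ s in cocompact ℂ, evalMat s (A * B) = evalMat s A * evalMat s B := by
  have h1 : ∀ i j, ∀ᶠ s in cocompact ℂ, evalAt s (∑ k, A i k * B k j)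
      = ∑ k, evalAt s (A i k * B k j) := fun i j => evalAt_sum _ _
  have h2 : ∀ i j k, ∀ᶠ s in cocompact ℂ, evalAt s (A i k * B k j)
      = evalAt s (A i k) * evalAt s (B k j) := fun i j k => evalAt_mul _ _
  simp only [← eventually_all] at h1 h2
  filter_upwards [h1, h2] with s h1 h2
  ext i j
  simp only [evalMat, Matrix.map_apply, Matrix.mul_apply, h1, h2]

theorem evalVec_mulVec {a b : ℕ} (A : Matrix (Fin a) (Fin b) (RatFunc ℝ))
    (v : Fin b → RatFunc ℝ) :
    ∀ᶠ s in cocompact ℂ, evalVec s (A *ᵥ v) = evalMat s A *ᵥ evalVec s v := by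
  have h1 : ∀ i, ∀ᶠ s in cocompact ℂ, evalAt s (∑ k, A i k * v k)
      = ∑ k, evalAt s (A i k * v k) := fun i => evalAt_sum _ _
  have h2 : ∀ i k, ∀ᶠ s in cocompact ℂ, evalAt s (A i k * v k)
      = evalAt s (A i k) * evalAt s (v k) := fun i k => evalAt_mul _ _
  simp only [← eventually_all] at h1 h2
  filter_upwards [h1, h2] with s h1 h2
  ext i
  simp only [evalVec, evalMat, Matrix.map_apply, Matrix.mulVec, dotProduct, h1, h2]

theorem evalMat_sub {a b : ℕ} (A B : Matrix (Fin a) (Fin b) (RatFunc ℝ)) :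
    ∀ᶠ s in cocompact ℂ, evalMat s (A - B) = evalMat s A - evalMat s B := by
  have h : ∀ i j, ∀ᶠ s in cocompact ℂ, evalAt s (A i j - B i j)
      = evalAt s (A i j) - evalAt s (B i j) := fun i j => evalAt_sub _ _
  simp only [← eventually_all] at h
  filter_upwards [h] with s h
  ext i j
  simp only [evalMat, Matrix.map_apply, Matrix.sub_apply, h]

theorem evalMat_smul {a b : ℕ} (g : RatFunc ℝ) (A : Matrix (Fin a) (Fin b) (RatFunc ℝ)) :
    ∀ᶠ s in cocompact ℂ, evalMat s (g • A) = evalAt s g • evalMat s A := by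
  have h : ∀ i j, ∀ᶠ s in cocompact ℂ, evalAt s (g * A i j)
      = evalAt s g * evalAt s (A i j) := fun i j => evalAt_mul _ _
  simp only [← eventually_all] at h
  filter_upwards [h] with s h
  ext i j
  simp only [evalMat, Matrix.map_apply, Matrix.smul_apply, smul_eq_mul, h]

@[simp] theorem evalMat_one {a : ℕ} (s : ℂ) :
    evalMat s (1 : Matrix (Fin a) (Fin a) (RatFunc ℝ)) = 1 := by
  ext i j
  by_cases h : i = j <;> simp [evalMat, h, Matrix.one_apply]

theorem evalAt_det {a : ℕ} (A : Matrix (Fin a) (Fin a) (RatFunc ℝ)) :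
    ∀ᶠ s in cocompact ℂ, evalAt s A.det = (evalMat s A).det := by
  have h1 : ∀ σ : Equiv.Perm (Fin a), ∀ᶠ s in cocompact ℂ,
      evalAt s ((Equiv.Perm.sign σ : ℤ) * ∏ i, A (σ i) i)
      = evalAt s (Equiv.Perm.sign σ : ℤ) * evalAt s (∏ i, A (σ i) i) := fun σ => evalAt_mul _ _
  have h2 : ∀ σ : Equiv.Perm (Fin a), ∀ᶠ s in cocompact ℂ,
      evalAt s (∏ i, A (σ i) i) = ∏ i, evalAt s (A (σ i) i) := fun σ => evalAt_prod _ _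
  simp only [← eventually_all] at h1 h2
  filter_upwards [h1, h2, evalAt_sum Finset.univ
    (fun σ : Equiv.Perm (Fin a) => ((Equiv.Perm.sign σ : ℤ) : RatFunc ℝ) * ∏ i, A (σ i) i)]
    with s h1 h2 h3
  rw [Matrix.det_apply', Matrix.det_apply', h3]
  simp only [h1, h2, evalAt_intCast, evalMat, Matrix.map_apply]

/-- A rational matrix whose values tend to an invertible matrix is invertible, and the values of
its inverse tend to the inverse of the limit. -/
theorem isUnit_and_tendsto_inv {a : ℕ} {A : Matrix (Fin a) (Fin a) (RatFunc ℝ)}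
    {B : Matrix (Fin a) (Fin a) ℂ}
    (h : Tendsto (fun s => evalMat s A) (cocompact ℂ) (𝓝 B)) (hB : B.det ≠ 0) :
    IsUnit A ∧ Tendsto (fun s => evalMat s A⁻¹) (cocompact ℂ) (𝓝 B⁻¹) := by
  have hdet : Tendsto (fun s => (evalMat s A).det) (cocompact ℂ) (𝓝 B.det) :=
    ((Continuous.matrix_det continuous_id).tendsto B).comp h
  have hne : A.det ≠ 0 := by
    intro h0
    refine hB (tendsto_nhds_unique (hdet.congr' ?_) tendsto_const_nhds)
    filter_upwards [evalAt_det A] with s hs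
    rw [← hs, h0, evalAt_zero]
  have hu : IsUnit A := (Matrix.isUnit_iff_isUnit_det A).2 (isUnit_iff_ne_zero.2 hne)
  refine ⟨hu, ?_⟩
  have hinv : ∀ᶠ s in cocompact ℂ, evalMat s A⁻¹ = (evalMat s A)⁻¹ := by
    filter_upwards [evalMat_mul A⁻¹ A] with s hs
    rw [Matrix.nonsing_inv_mul _ (isUnit_iff_ne_zero.2 hne), evalMat_one] at hs
    exact (Matrix.inv_eq_left_inv hs.symm).symm
  have hlim : Tendsto (fun s => (evalMat s A)⁻¹) (cocompact ℂ) (𝓝 B⁻¹) := by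
    simp only [Matrix.inv_def, Ring.inverse_eq_inv']
    exact (hdet.inv₀ hB).smul
      (((Continuous.matrix_adjugate continuous_id).tendsto B).comp h)
  exact hlim.congr' (hinv.mono fun s hs => hs.symm)

/-- A strictly proper rational function has a numerator of smaller degree than its
denominator. -/
theorem StrictlyProper.degree_lt {g : RatFunc ℝ} (h : StrictlyProper g) :
    g.num.degree < g.denom.degree := by
  rw [← Polynomial.div_tendsto_atTop_zero_iff_degree_lt _ _ g.denom_ne_zero]
  -- Restricting to the positive real axis reduces the claim to the growth of a quotient of real
  -- polynomials.
  have h1 : Tendsto (fun x : ℝ => (x : ℂ)) atTop (cocompact ℂ) := by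
    rw [← Metric.cobounded_eq_cocompact, ← tendsto_norm_atTop_iff_cobounded]
    simpa using tendsto_abs_atTop_atTop
  have h2 := (Complex.continuous_re.tendsto 0).comp (h.comp h1)
  refine h2.congr fun x => ?_
  have hx : ∀ p : Polynomial ℝ, Polynomial.eval₂ (algebraMap ℝ ℂ) (x : ℂ) p = (p.eval x : ℝ) := by
    intro p
    exact Polynomial.eval₂_at_apply (algebraMap ℝ ℂ) x
  simp only [Function.comp, evalAt, RatFunc.eval, hx]
  rw [← Complex.ofReal_div, Complex.ofReal_re]

/-! ### Half-planes and Laplace transforms of complex signals. -/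

/-- Carries rational identities, valid off a bounded set, over to the half-planes where transforms
live. -/
theorem rightHalfPlanes_le_cocompact : rightHalfPlanes ≤ cocompact ℂ := by
  rw [← Metric.cobounded_eq_cocompact, ← comap_norm_atTop, rightHalfPlanes]
  refine tendsto_iff_comap.1 (tendsto_atTop_mono (fun s => ?_) tendsto_comap)
  exact (le_abs_self _).trans (Complex.abs_re_le_norm s)

theorem eventually_rightHalfPlanes {P : ℂ → Prop} :
    (∀ᶠ s in rightHalfPlanes, P s) ↔ ∃ R : ℝ, ∀ s : ℂ, R ≤ s.re → P s := by
  have := (atTop_basis (α := ℝ)).comap Complex.re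
  rw [rightHalfPlanes, this.eventually_iff]
  simp

/-- The complex signal `f` on `[0, ∞)` has a Laplace transform. -/
def Transformable (f : ℝ → ℂ) : Prop :=
  ∃ σ : ℝ, IntegrableOn (fun t : ℝ => Complex.exp (-(σ : ℂ) * t) * f t) (Ioi 0)

/-- The Laplace transform of a complex signal. -/
def lap (f : ℝ → ℂ) (s : ℂ) : ℂ := ∫ t in Ioi (0 : ℝ), Complex.exp (-s * t) * f t

/-- The convolution of two signals on `[0, ∞)`. -/
def conv (f h : ℝ → ℂ) (t : ℝ) : ℂ := ∫ x in (0 : ℝ)..t, f x * h (t - x)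

theorem integrableOn_exp_mul_of_le {f : ℝ → ℂ} {σ : ℝ} {s : ℂ} (hs : σ ≤ s.re)
    (hf : IntegrableOn (fun t : ℝ => Complex.exp (-(σ : ℂ) * t) * f t) (Ioi 0)) :
    IntegrableOn (fun t : ℝ => Complex.exp (-s * t) * f t) (Ioi 0) := by
  have hb : ∀ᵐ t : ℝ ∂(volume.restrict (Ioi (0 : ℝ))),
      ‖Complex.exp (-(s - σ) * t)‖ ≤ 1 := by
    refine (ae_restrict_iff' measurableSet_Ioi).2 (Eventually.of_forall fun t (ht : 0 < t) => ?_)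
    rw [Complex.norm_exp]
    have : (-(s - σ) * t).re = -((s.re - σ) * t) := by simp; ring
    rw [this, Real.exp_le_one_iff, neg_nonpos]
    exact mul_nonneg (sub_nonneg.2 hs) ht.le
  have hc : Continuous fun t : ℝ => Complex.exp (-(s - σ) * t) := by fun_prop
  refine (Integrable.bdd_mul hf hc.aestronglyMeasurable hb).congr (Eventually.of_forall fun t => ?_)
  simp only [← mul_assoc, ← Complex.exp_add]
  ring_nf

theorem transformable_iff {f : ℝ → ℂ} : Transformable f ↔ ∀ᶠ s in rightHalfPlanes,
    IntegrableOn (fun t : ℝ => Complex.exp (-s * t) * f t) (Ioi 0) := by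
  rw [eventually_rightHalfPlanes]
  constructor
  · rintro ⟨σ, hσ⟩
    exact ⟨σ, fun s hs => integrableOn_exp_mul_of_le hs hσ⟩
  · rintro ⟨R, hR⟩
    exact ⟨R, hR R (by simp)⟩

theorem transformable_zero : Transformable (fun _ => 0) := ⟨0, by simp⟩

theorem Transformable.add {f g : ℝ → ℂ} (hf : Transformable f) (hg : Transformable g) :
    Transformable (fun t => f t + g t) := by
  rw [transformable_iff] at *
  filter_upwards [hf, hg] with s h1 h2
  simp only [mul_add]
  exact Integrable.add h1 h2

theorem lap_add {f g : ℝ → ℂ} (hf : Transformable f) (hg : Transformable g) :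
    ∀ᶠ s in rightHalfPlanes, lap (fun t => f t + g t) s = lap f s + lap g s := by
  rw [transformable_iff] at *
  filter_upwards [hf, hg] with s h1 h2
  simp only [lap, mul_add]
  exact integral_add h1 h2

theorem Transformable.const_mul {f : ℝ → ℂ} (hf : Transformable f) (c : ℂ) :
    Transformable (fun t => c * f t) := by
  obtain ⟨σ, hσ⟩ := hf
  refine ⟨σ, ?_⟩
  simp only [mul_left_comm _ c]
  exact Integrable.const_mul hσ c

theorem lap_const_mul (f : ℝ → ℂ) (c s : ℂ) : lap (fun t => c * f t) s = c * lap f s := by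
  simp only [lap, mul_left_comm _ c]
  exact integral_const_mul _ _

/-- The weight `exp (-s t)` splits over `t = x + (t - x)`, so the weighted convolution is the
convolution of the weighted signals, to which Fubini in the form of `integral_posConvolution`
applies. -/
theorem transformable_conv_and_lap_conv {f h : ℝ → ℂ} (hf : Transformable f)
    (hh : Transformable h) : Transformable (conv f h) ∧
    ∀ᶠ s in rightHalfPlanes, lap (conv f h) s = lap f s * lap h s := by
  rw [transformable_iff] at *
  have key : ∀ (s : ℂ) (t : ℝ), Complex.exp (-s * t) * conv f h t =
      ∫ x in (0 : ℝ)..t, ContinuousLinearMap.mul ℝ ℂ (Complex.exp (-s * x) * f x)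
        (Complex.exp (-s * (t - x : ℝ)) * h (t - x)) := by
    intro s t
    rw [conv, ← intervalIntegral.integral_const_mul]
    refine intervalIntegral.integral_congr fun x _ => ?_
    have : Complex.exp (-s * t) = Complex.exp (-s * x) * Complex.exp (-s * (t - x : ℝ)) := by
      rw [← Complex.exp_add]; push_cast; ring_nf
    simp only [ContinuousLinearMap.mul_apply', this]
    ring
  constructor
  · filter_upwards [hf, hh] with s h1 h2
    refine ((integrable_posConvolution h1 h2 (ContinuousLinearMap.mul ℝ ℂ)).integrableOn
      (s := Ioi 0)).congr ?_
    refine (ae_restrict_iff' measurableSet_Ioi).2 (Eventually.of_forall fun t ht => ?_)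
    rw [posConvolution, indicator_of_mem ht]
    exact (key s t).symm
  · filter_upwards [hf, hh] with s h1 h2
    have := integral_posConvolution h1 h2 (ContinuousLinearMap.mul ℝ ℂ)
    simp only [← key] at this
    exact this

theorem transformable_exp_and_lap_exp (a : ℂ) :
    Transformable (fun t : ℝ => Complex.exp (a * t)) ∧
    ∀ᶠ s in rightHalfPlanes, lap (fun t : ℝ => Complex.exp (a * t)) s = 1 / (s - a) := by
  have key : ∀ (s : ℂ) (t : ℝ), Complex.exp (-s * t) * Complex.exp (a * t)
      = Complex.exp ((a - s) * t) := by
    intro s t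
    rw [← Complex.exp_add]; ring_nf
  rw [transformable_iff, ← eventually_and, eventually_rightHalfPlanes]
  refine ⟨a.re + 1, fun s hs => ?_⟩
  have hneg : (a - s).re < 0 := by simp; linarith
  simp only [lap, key]
  refine ⟨integrableOn_exp_mul_complex_Ioi hneg 0, ?_⟩
  rw [integral_exp_mul_complex_Ioi hneg 0]
  have h0 : s - a ≠ 0 := fun h => by
    rw [show a - s = -(s - a) by ring, h] at hneg; simp at hneg
  have h1 : a - s ≠ 0 := fun h => h0 (by linear_combination -h)
  simp only [Complex.ofReal_zero, mul_zero, Complex.exp_zero]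
  field_simp
  ring

theorem Transformable.intervalIntegrable {f : ℝ → ℂ} (hf : Transformable f) {t : ℝ}
    (ht : 0 ≤ t) : IntervalIntegrable f volume 0 t := by
  obtain ⟨σ, hσ⟩ := hf
  have h1 : IntegrableOn (fun t : ℝ => Complex.exp (-(σ : ℂ) * t) * f t) (Ioc 0 t) :=
    hσ.mono_set Ioc_subset_Ioi_self
  have h2 := (((intervalIntegrable_iff_integrableOn_Ioc_of_le ht).2 h1).continuousOn_mul
    (g := fun t : ℝ => Complex.exp ((σ : ℂ) * t)) (by fun_prop))
  refine h2.congr fun x _ => ?_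
  simp only [← mul_assoc, ← Complex.exp_add]
  simp

/-- Dominated convergence with `t` both as parameter and as endpoint. Only `h` is continuous: inputs
are merely integrable. -/
theorem continuousOn_conv {f h : ℝ → ℂ} (hf : Transformable f) (hh : Continuous h) :
    ContinuousOn (conv f h) (Ici 0) := by
  intro b₀ hb₀
  have hb₀' : 0 ≤ b₀ := hb₀
  -- Nothing is known of `f` at negative times, but a two-sided neighbourhood of the endpoint is
  -- needed even at `b₀ = 0`; hence the extension by zero.
  set F := indicator (Ioi (0 : ℝ)) f with hF
  have hFint : IntervalIntegrable F volume (-1) (b₀ + 1) := by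
    rw [intervalIntegrable_iff_integrableOn_Ioc_of_le (by linarith), IntegrableOn, hF,
      integrable_indicator_iff measurableSet_Ioi, IntegrableOn,
      Measure.restrict_restrict measurableSet_Ioi]
    have := (intervalIntegrable_iff_integrableOn_Ioc_of_le (by linarith)).1
      (hf.intervalIntegrable (t := b₀ + 1) (by linarith))
    exact this.mono_set fun x hx => ⟨hx.1, hx.2.2⟩
  -- For `x` within 1 of `b₀` and `0 < t ≤ b₀ + 1`, the argument `x - t` stays in this interval.
  obtain ⟨C, hC⟩ := (isCompact_Icc (a := -2) (b := b₀ + 2)).exists_bound_of_continuousOn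
    hh.continuousOn
  have hcont : ContinuousAt (fun p : ℝ × ℝ => ∫ t in (0 : ℝ)..p.2, F t * h (p.1 - t))
      (b₀, b₀) := by
    refine intervalIntegral.continuousAt_parametric_primitive_of_dominated
      (a₀ := 0) (b₀ := b₀) (x₀ := b₀) (F := fun x t => F t * h (x - t)) (fun t => ‖F t‖ * C) (-1) (b₀ + 1) (fun x => ?_) ?_ ?_ ?_ ⟨by norm_num, by linarith⟩
      ⟨by linarith, by linarith⟩ (by simp)
    · exact hFint.def'.aestronglyMeasurable.mul
        (hh.comp (by fun_prop : Continuous fun t : ℝ => x - t)).aestronglyMeasurable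
    · filter_upwards [Ioo_mem_nhds (by linarith : b₀ - 1 < b₀) (by linarith : b₀ < b₀ + 1)]
        with x hx
      refine (ae_restrict_iff' measurableSet_uIoc).2 (Eventually.of_forall fun t ht => ?_)
      rw [uIoc_of_le (by linarith)] at ht
      rw [norm_mul]
      by_cases h0 : 0 < t
      · by_cases h1 : -2 ≤ x - t
        · refine mul_le_mul_of_nonneg_left (hC _ ⟨h1, ?_⟩) (norm_nonneg _)
          linarith [hx.2]
        · exfalso; linarith [hx.1, ht.2]
      · have : F t = 0 := indicator_of_notMem h0 f
        simp [this]
    · exact hFint.norm.mul_const C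
    · exact Eventually.of_forall fun t => by fun_prop
  have hdiag : ContinuousAt (fun t : ℝ => ∫ x in (0 : ℝ)..t, F x * h (t - x)) b₀ :=
    hcont.comp (f := fun t : ℝ => (t, t)) (by fun_prop : ContinuousAt (fun t : ℝ => (t, t)) b₀)
  have heq : ∀ t ∈ Ici (0 : ℝ), conv f h t = ∫ x in (0 : ℝ)..t, F x * h (t - x) := by
    intro t ht
    refine intervalIntegral.integral_congr_ae (Eventually.of_forall fun x hx => ?_)
    rw [uIoc_of_le ht] at hx
    rw [hF, indicator_of_mem (show x ∈ Ioi (0 : ℝ) from hx.1)]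
  exact (hdiag.continuousWithinAt).congr heq (heq b₀ hb₀)

theorem continuous_conv {f h : ℝ → ℂ} (hf : Continuous f) (hh : Continuous h) :
    Continuous (conv f h) :=
  intervalIntegral.continuous_parametric_intervalIntegral_of_continuous (by fun_prop)
    continuous_id

/-! ### Inverse transforms of strictly proper rational functions. -/

open Polynomial in
/-- Strictly proper rational functions are Laplace transforms of continuous functions. -/
theorem exists_lap_eq_div_complex (n : ℕ) : ∀ (D N : ℂ[X]), D.natDegree = n → D ≠ 0 →
    N.degree < D.degree → ∃ h : ℝ → ℂ, Continuous h ∧ Transformable h ∧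
      ∀ᶠ s in rightHalfPlanes, lap h s = N.eval s / D.eval s := by
  induction n with
  | zero =>
    intro D N hD hD0 hN
    rw [degree_eq_natDegree hD0, hD, Nat.cast_zero] at hN
    have : N = 0 := by
      rw [← degree_eq_bot]; exact Nat.WithBot.lt_zero_iff.1 hN
    refine ⟨fun _ => 0, continuous_const, transformable_zero, Eventually.of_forall fun s => ?_⟩
    simp [this, lap]
  | succ n ih =>
    intro D N hD hD0 hN
    obtain ⟨a, ha⟩ := IsAlgClosed.exists_root D (by
      rw [degree_eq_natDegree hD0, hD]; exact_mod_cast n.succ_ne_zero)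
    obtain ⟨E, rfl⟩ := dvd_iff_isRoot.2 ha
    have hE0 : E ≠ 0 := right_ne_zero_of_mul hD0
    have hE : E.natDegree = n := by
      rw [natDegree_mul (X_sub_C_ne_zero a) hE0, natDegree_X_sub_C] at hD
      omega
    -- Peel off the root `a`: `N / ((s - a) E) = c / (s - a) + (1 / (s - a)) * ((N - c E) / E)`.
    -- This `c` cancels the coefficient of degree `n`, so the induction hypothesis applies to the
    -- last factor and the product becomes a convolution.
    set c := N.coeff n / E.leadingCoeff with hc
    have hlc : E.leadingCoeff ≠ 0 := leadingCoeff_ne_zero.2 hE0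
    have hN' : (N - C c * E).degree < E.degree := by
      rw [degree_eq_natDegree hE0, hE, degree_lt_iff_coeff_zero]
      intro m hm
      rcases hm.eq_or_lt with rfl | hm
      · rw [coeff_sub, coeff_C_mul, hc]
        have : E.coeff n = E.leadingCoeff := by rw [leadingCoeff, hE]
        rw [this]; field_simp; ring
      · rw [coeff_sub, coeff_C_mul, coeff_eq_zero_of_natDegree_lt (p := E) (hE.trans_lt hm),
          coeff_eq_zero_of_degree_lt (p := N) (hN.trans_le ?_)]
        · simp
        · rw [degree_eq_natDegree hD0, hD]; exact_mod_cast hm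
    obtain ⟨h, hcont, ht, hl⟩ := ih E (N - C c * E) hE hE0 hN'
    obtain ⟨ht₁, hl₁⟩ := transformable_exp_and_lap_exp a
    obtain ⟨ht₂, hl₂⟩ := transformable_conv_and_lap_conv ht₁ ht
    have hce : Continuous fun t : ℝ => Complex.exp (a * t) := by fun_prop
    refine ⟨fun t => c * Complex.exp (a * t) + conv (fun t : ℝ => Complex.exp (a * t)) h t,
      (continuous_const.mul hce).add (continuous_conv hce hcont), (ht₁.const_mul c).add ht₂, ?_⟩
    have hroot : ∀ᶠ s in rightHalfPlanes, ((X - C a) * E).eval s ≠ 0 := by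
      refine rightHalfPlanes_le_cocompact ?_
      exact (finite_setOfPred_isRoot hD0).isCompact.compl_mem_cocompact
    filter_upwards [hl, hl₁, hl₂, lap_add (ht₁.const_mul c) ht₂, hroot] with s h1 h2 h3 h4 h5
    rw [h4, lap_const_mul, h3, h1, h2]
    simp only [eval_mul, eval_sub, eval_X, eval_C] at h5 ⊢
    have h6 := left_ne_zero_of_mul h5
    have h7 := right_ne_zero_of_mul h5
    field_simp
    ring

theorem Transformable.conj {h : ℝ → ℂ} (hh : Transformable h) :
    Transformable (fun t => starRingEnd ℂ (h t)) := by
  obtain ⟨σ, hσ⟩ := hh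
  refine ⟨σ, (Complex.conjCLE.toContinuousLinearMap.integrable_comp hσ).congr
    (Eventually.of_forall fun t => ?_)⟩
  simp [← Complex.exp_conj]

theorem lap_conj (h : ℝ → ℂ) (s : ℂ) :
    lap (fun t => starRingEnd ℂ (h t)) s = starRingEnd ℂ (lap h (starRingEnd ℂ s)) := by
  rw [lap, lap, ← integral_conj]
  congr 1
  ext t
  simp [← Complex.exp_conj]

open Polynomial in
/-- Strictly proper real rational functions are Laplace transforms of continuous real
functions. -/
theorem exists_lap_eq_div {D N : ℝ[X]} (hD : D ≠ 0) (hN : N.degree < D.degree) :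
    ∃ h : ℝ → ℝ, Continuous h ∧ Transformable (fun t => (h t : ℂ)) ∧
      ∀ᶠ s in rightHalfPlanes, lap (fun t => (h t : ℂ)) s =
        N.eval₂ (algebraMap ℝ ℂ) s / D.eval₂ (algebraMap ℝ ℂ) s := by
  obtain ⟨h, hc, ht, hl⟩ := exists_lap_eq_div_complex _ (D.map (algebraMap ℝ ℂ))
    (N.map (algebraMap ℝ ℂ)) rfl ((Polynomial.map_ne_zero_iff (algebraMap ℝ ℂ).injective).2 hD)
    (by simpa using hN)
  simp only [eval_map] at hl
  -- With real coefficients the quotient commutes with conjugation, so `h` and its conjugate have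
  -- the same transform, and so does their mean.
  have hre : (fun t => ((h t).re : ℂ)) =
      fun t => (1 / 2 : ℂ) * (h t + starRingEnd ℂ (h t)) := by
    ext t
    rw [Complex.re_eq_add_conj]; ring
  refine ⟨fun t => (h t).re, Complex.continuous_re.comp hc, ?_, ?_⟩
  · rw [hre]
    exact (ht.add ht.conj).const_mul _
  rw [hre]
  have hl' : ∀ᶠ s in rightHalfPlanes, lap h (starRingEnd ℂ s) =
      N.eval₂ (algebraMap ℝ ℂ) (starRingEnd ℂ s) / D.eval₂ (algebraMap ℝ ℂ) (starRingEnd ℂ s) := by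
    rw [eventually_rightHalfPlanes] at hl ⊢
    obtain ⟨R, hR⟩ := hl
    exact ⟨R, fun s hs => hR _ (by simpa using hs)⟩
  have hcj : ∀ (p : ℝ[X]) (s : ℂ), p.eval₂ (algebraMap ℝ ℂ) (starRingEnd ℂ s) =
      starRingEnd ℂ (p.eval₂ (algebraMap ℝ ℂ) s) := by
    intro p s
    rw [hom_eval₂]
    congr 1
    ext x; simp
  filter_upwards [hl, hl', lap_add ht ht.conj] with s h1 h2 h3
  rw [lap_const_mul, h3, lap_conj, h1, h2, hcj, hcj, ← map_div₀, Complex.conj_conj]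
  ring

/-! ### Injectivity of the Laplace transform. -/

/-- A real signal with vanishing Laplace transform vanishes almost everywhere. -/
theorem ae_eq_zero_of_lap_eq_zero {f : ℝ → ℝ} (hf : Transformable (fun t => (f t : ℂ)))
    (h : ∀ᶠ s in rightHalfPlanes, lap (fun t => (f t : ℂ)) s = 0) :
    f =ᵐ[volume.restrict (Ioi 0)] fun _ => 0 := by
  rw [transformable_iff] at hf
  obtain ⟨σ, hσ⟩ := eventually_rightHalfPlanes.1 (hf.and h)
  set ν := volume.restrict (Ioi (0 : ℝ))
  set g : ℝ → ℝ := fun t => Real.exp (-σ * t) * f t with hg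
  have hgC : ∀ t, (g t : ℂ) = Complex.exp (-(σ : ℂ) * t) * f t := fun t => by
    simp [hg]
  have hgint : Integrable g ν := by
    have := (hσ σ (by simp)).1
    simp only [← hgC] at this
    simpa using this.re
  -- On the vertical line `Re s = σ` the transform is the Fourier transform of the integrable
  -- function `g`.
  have hft : ∀ ω : ℝ, ∫ t, (g t : ℂ) * Complex.exp (ω * t * Complex.I) ∂ν = 0 := by
    intro ω
    rw [← (hσ (σ - ω * Complex.I) (by simp)).2, lap]
    refine integral_congr_ae (Eventually.of_forall fun t => ?_)
    simp only [hgC]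
    rw [mul_right_comm, ← Complex.exp_add]
    ring_nf
  have hfin : ∀ k : ℝ → ℝ, Integrable k ν →
      IsFiniteMeasure (ν.withDensity fun t => ENNReal.ofReal (k t)) := fun k hk =>
    isFiniteMeasure_withDensity_ofReal hk.2
  have hgneg : Integrable (fun t => -g t) ν := hgint.neg
  have := hfin g hgint
  have := hfin (fun t => -g t) hgneg
  have hint : ∀ k : ℝ → ℝ, Integrable k ν → ∀ ω : ℝ,
      charFun (ν.withDensity fun t => ENNReal.ofReal (k t)) ω
        = ∫ t, ((max (k t) 0 : ℝ) : ℂ) * Complex.exp (ω * t * Complex.I) ∂ν := by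
    intro k hk ω
    rw [charFun_apply_real, integral_withDensity_eq_integral_toReal_smul₀
      hk.aemeasurable.ennreal_ofReal (by simp)]
    simp [ENNReal.toReal_ofReal']
  have hI : ∀ k : ℝ → ℝ, Integrable k ν → ∀ ω : ℝ,
      Integrable (fun t => (k t : ℂ) * Complex.exp (ω * t * Complex.I)) ν := by
    intro k hk ω
    have hc : Continuous fun t : ℝ => Complex.exp (ω * t * Complex.I) := by fun_prop
    refine Integrable.mul_bdd (c := 1) hk.ofReal hc.aestronglyMeasurable
      (Eventually.of_forall fun t => ?_)
    rw [show (ω * t * Complex.I : ℂ) = ((ω * t : ℝ) : ℂ) * Complex.I by push_cast; ring,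
      Complex.norm_exp_ofReal_mul_I]
  -- The positive and negative parts of `g` are densities of finite measures with equal
  -- characteristic functions, so the parts agree almost everywhere; at most one is nonzero at each
  -- point, hence `g = 0`.
  have hEq : (ν.withDensity fun t => ENNReal.ofReal (g t))
      = ν.withDensity fun t => ENNReal.ofReal (-g t) := by
    refine Measure.ext_of_charFun (funext fun ω => ?_)
    rw [hint g hgint, hint (fun t => -g t) hgneg, ← sub_eq_zero,
      ← integral_sub (hI _ hgint.pos_part ω) (hI _ hgneg.pos_part ω), ← hft ω]
    refine integral_congr_ae (Eventually.of_forall fun t => ?_)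
    simp only
    rw [← sub_mul, ← Complex.ofReal_sub]
    congr 2
    exact max_zero_sub_max_neg_zero_eq_self (g t)
  rw [withDensity_eq_iff_of_sigmaFinite hgint.aemeasurable.ennreal_ofReal
    hgneg.aemeasurable.ennreal_ofReal] at hEq
  filter_upwards [hEq] with t ht
  have h0 : g t = 0 := by
    rcases le_total 0 (g t) with h0 | h0
    · rw [ENNReal.ofReal_of_nonpos (neg_nonpos.2 h0), ENNReal.ofReal_eq_zero] at ht
      exact le_antisymm ht h0
    · rw [ENNReal.ofReal_of_nonpos h0, eq_comm, ENNReal.ofReal_eq_zero] at ht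
      linarith
  exact (mul_eq_zero.1 h0).resolve_left (Real.exp_pos _).ne'

/-! ### Vector signals and their primitives. -/

theorem laplaceTransformable_iff {n : ℕ} {f : ℝ → Fin n → ℝ} :
    LaplaceTransformable f ↔ ∀ i, Transformable (fun t => (f t i : ℂ)) := by
  have key : ∀ (σ : ℝ) (i : Fin n) (t : ℝ),
      ((Real.exp (-σ * t) • f t) i : ℂ) = Complex.exp (-(σ : ℂ) * t) * f t i := by
    intro σ i t; simp
  constructor
  · rintro ⟨σ, hσ⟩ i
    refine ⟨σ, ?_⟩
    simp only [← key]
    exact (hσ.eval i).ofReal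
  · intro h
    have h' : ∀ i, ∀ᶠ s in rightHalfPlanes,
        IntegrableOn (fun t : ℝ => Complex.exp (-s * t) * (f t i : ℂ)) (Ioi 0) :=
      fun i => transformable_iff.1 (h i)
    rw [← eventually_all, eventually_rightHalfPlanes] at h'
    obtain ⟨σ, hσ⟩ := h'
    refine ⟨σ, Integrable.of_eval fun i => ?_⟩
    have := hσ σ (by simp) i
    simp only [← key] at this
    exact Integrable.re this

theorem laplace_apply {n : ℕ} (f : ℝ → Fin n → ℝ) (s : ℂ) (i : Fin n) :
    laplace f s i = lap (fun t => (f t i : ℂ)) s := rfl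

theorem LaplaceTransformable.congr {n : ℕ} {f g : ℝ → Fin n → ℝ} (hf : LaplaceTransformable f)
    (h : f =ᵐ[volume.restrict (Ioi 0)] g) : LaplaceTransformable g := by
  obtain ⟨σ, hσ⟩ := hf
  exact ⟨σ, Integrable.congr hσ (h.mono fun t ht => by simp only [ht])⟩

theorem laplace_congr {n : ℕ} {f g : ℝ → Fin n → ℝ} (h : f =ᵐ[volume.restrict (Ioi 0)] g) :
    laplace f = laplace g := by
  ext s i
  exact integral_congr_ae (h.mono fun t ht => by simp only [ht])

theorem LaplaceTransformable.add {n : ℕ} {f g : ℝ → Fin n → ℝ} (hf : LaplaceTransformable f)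
    (hg : LaplaceTransformable g) : LaplaceTransformable (fun t => f t + g t) := by
  rw [laplaceTransformable_iff] at *
  intro i
  simpa using (hf i).add (hg i)

theorem laplace_add {n : ℕ} {f g : ℝ → Fin n → ℝ} (hf : LaplaceTransformable f)
    (hg : LaplaceTransformable g) :
    ∀ᶠ s in rightHalfPlanes, laplace (fun t => f t + g t) s = laplace f s + laplace g s := by
  rw [laplaceTransformable_iff] at *
  have : ∀ i, ∀ᶠ s in rightHalfPlanes, lap (fun t => (f t i : ℂ) + (g t i : ℂ)) s
      = lap (fun t => (f t i : ℂ)) s + lap (fun t => (g t i : ℂ)) s :=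
    fun i => lap_add (hf i) (hg i)
  filter_upwards [eventually_all.2 this] with s hs
  ext i
  simpa [laplace_apply] using hs i

theorem LaplaceTransformable.neg {n : ℕ} {f : ℝ → Fin n → ℝ} (hf : LaplaceTransformable f) :
    LaplaceTransformable (fun t => -f t) := by
  rw [laplaceTransformable_iff] at *
  intro i
  simpa using (hf i).const_mul (-1)

theorem laplace_neg {n : ℕ} (f : ℝ → Fin n → ℝ) (s : ℂ) :
    laplace (fun t => -f t) s = -laplace f s := by
  ext i
  simpa [laplace_apply] using lap_const_mul (fun t => (f t i : ℂ)) (-1) s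

theorem LaplaceTransformable.sub {n : ℕ} {f g : ℝ → Fin n → ℝ} (hf : LaplaceTransformable f)
    (hg : LaplaceTransformable g) : LaplaceTransformable (fun t => f t - g t) := by
  simpa only [sub_eq_add_neg] using hf.add hg.neg

theorem laplace_sub {n : ℕ} {f g : ℝ → Fin n → ℝ} (hf : LaplaceTransformable f)
    (hg : LaplaceTransformable g) :
    ∀ᶠ s in rightHalfPlanes, laplace (fun t => f t - g t) s = laplace f s - laplace g s := by
  filter_upwards [laplace_add hf hg.neg] with s hs
  simpa only [sub_eq_add_neg, laplace_neg] using hs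

/-- The Laplace transform determines a signal almost everywhere. -/
theorem ae_eq_of_laplace_eq {n : ℕ} {f g : ℝ → Fin n → ℝ} (hf : LaplaceTransformable f)
    (hg : LaplaceTransformable g)
    (h : ∀ᶠ s in rightHalfPlanes, laplace f s = laplace g s) :
    f =ᵐ[volume.restrict (Ioi 0)] g := by
  have hi : ∀ i, ∀ᵐ t ∂(volume.restrict (Ioi (0 : ℝ))), f t i - g t i = 0 := by
    intro i
    refine ae_eq_zero_of_lap_eq_zero (f := fun t => f t i - g t i)
      (laplaceTransformable_iff.1 (hf.sub hg) i) ?_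
    filter_upwards [h, laplace_sub hf hg] with s h1 h2
    rw [h1, sub_self] at h2
    exact congrFun h2 i
  filter_upwards [ae_all_iff.2 hi] with t ht
  exact funext fun i => sub_eq_zero.1 (ht i)

theorem LaplaceTransformable.intervalIntegrable {n : ℕ} {f : ℝ → Fin n → ℝ}
    (hf : LaplaceTransformable f) (i : Fin n) {t : ℝ} (ht : 0 ≤ t) :
    IntervalIntegrable (fun x => f x i) volume 0 t := by
  have := (laplaceTransformable_iff.1 hf i).intervalIntegrable ht
  rw [intervalIntegrable_iff] at this ⊢
  exact Integrable.re this

/-- The primitive `∫₀ᵗ f` of a signal. -/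
def primitive {n : ℕ} (f : ℝ → Fin n → ℝ) (t : ℝ) : Fin n → ℝ :=
  fun i => ∫ x in (0 : ℝ)..t, f x i

theorem primitive_zero {n : ℕ} (f : ℝ → Fin n → ℝ) : primitive f 0 = 0 := by
  ext i; simp [primitive]

/-- Integration is convolution with the constant 1, written as an exponential so that the
convolution and exponential lemmas apply. -/
theorem ofReal_primitive {n : ℕ} (f : ℝ → Fin n → ℝ) (i : Fin n) :
    (fun t => (primitive f t i : ℂ)) =
      conv (fun t => (f t i : ℂ)) (fun t : ℝ => Complex.exp (0 * t)) := by
  ext t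
  simp [primitive, conv, intervalIntegral.integral_ofReal]

theorem LaplaceTransformable.primitive {n : ℕ} {f : ℝ → Fin n → ℝ}
    (hf : LaplaceTransformable f) : LaplaceTransformable (primitive f) := by
  rw [laplaceTransformable_iff] at *
  intro i
  rw [ofReal_primitive]
  exact (transformable_conv_and_lap_conv (hf i) (transformable_exp_and_lap_exp 0).1).1

theorem laplace_primitive {n : ℕ} {f : ℝ → Fin n → ℝ} (hf : LaplaceTransformable f) :
    ∀ᶠ s in rightHalfPlanes, laplace (primitive f) s = s⁻¹ • laplace f s := by
  rw [laplaceTransformable_iff] at hf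
  have := fun i =>
    (transformable_conv_and_lap_conv (hf i) (transformable_exp_and_lap_exp 0).1).2
  filter_upwards [eventually_all.2 this, (transformable_exp_and_lap_exp 0).2] with s hs h0
  ext i
  rw [laplace_apply, ofReal_primitive, hs i, h0]
  simp [laplace_apply, mul_comm]

theorem continuousOn_primitive {n : ℕ} {f : ℝ → Fin n → ℝ} (hf : LaplaceTransformable f) :
    ContinuousOn (primitive f) (Ici 0) := by
  refine continuousOn_pi.2 fun i => ?_
  have h := continuousOn_conv (laplaceTransformable_iff.1 hf i)
    (by fun_prop : Continuous fun t : ℝ => Complex.exp (0 * t))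
  rw [← ofReal_primitive] at h
  exact Complex.continuous_re.comp_continuousOn h

/-! ### Proper rational matrices as causal operators. -/

/-- The causal operator with feedthrough matrix `C` and impulse response `K`. -/
def causalOp {a b : ℕ} (C : Matrix (Fin a) (Fin b) ℝ) (K : Fin a → Fin b → ℝ → ℝ)
    (f : ℝ → Fin b → ℝ) (t : ℝ) : Fin a → ℝ :=
  fun i => ∑ j, (C i j * f t j + ∫ x in (0 : ℝ)..t, f x j * K i j (t - x))

/-- `C` and `K` are the feedthrough matrix and the impulse response of the rational matrix `R`. -/
structure IsImpulseResponse {a b : ℕ} (R : Matrix (Fin a) (Fin b) (RatFunc ℝ))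
    (C : Matrix (Fin a) (Fin b) ℝ) (K : Fin a → Fin b → ℝ → ℝ) : Prop where
  continuous : ∀ i j, Continuous (K i j)
  transformable : ∀ i j, Transformable (fun t => (K i j t : ℂ))
  evalAt_eq : ∀ i j, ∀ᶠ s in rightHalfPlanes,
    evalAt s (R i j) = C i j + lap (fun t => (K i j t : ℂ)) s

/-- Subtracting the limit at infinity leaves strictly proper entries, which have continuous inverse
transforms. -/
theorem exists_isImpulseResponse {a b : ℕ} {R : Matrix (Fin a) (Fin b) (RatFunc ℝ)}
    {C : Matrix (Fin a) (Fin b) ℝ}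
    (h : Tendsto (fun s => evalMat s R) (cocompact ℂ) (𝓝 (C.map (algebraMap ℝ ℂ)))) :
    ∃ K, IsImpulseResponse R C K := by
  have key : ∀ i j, ∃ k : ℝ → ℝ, Continuous k ∧ Transformable (fun t => (k t : ℂ)) ∧
      ∀ᶠ s in rightHalfPlanes, evalAt s (R i j) = C i j + lap (fun t => (k t : ℂ)) s := by
    intro i j
    have hsub := evalAt_sub (R i j) (RatFunc.C (C i j))
    have hsp : StrictlyProper (R i j - RatFunc.C (C i j)) := by
      have h1 := ((tendsto_pi_nhds.1 ((tendsto_pi_nhds.1 h) i)) j).sub_const (C i j : ℂ)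
      have h2 : C.map (algebraMap ℝ ℂ) i j - (C i j : ℂ) = 0 := by simp
      rw [h2] at h1
      refine h1.congr' (hsub.mono fun s hs => ?_)
      exact ((hs.trans (by rw [evalAt_C]; rfl)).symm)
    obtain ⟨k, hk, ht, hl⟩ := exists_lap_eq_div (RatFunc.denom_ne_zero _) hsp.degree_lt
    refine ⟨k, hk, ht, ?_⟩
    filter_upwards [hl, rightHalfPlanes_le_cocompact hsub] with s h1 h2
    rw [h1]
    change _ = _ + evalAt s (R i j - RatFunc.C (C i j))
    rw [h2, evalAt_C]; ring
  choose K h1 h2 h3 using key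
  exact ⟨K, h1, h2, h3⟩

theorem ofReal_causalOp {a b : ℕ} (C : Matrix (Fin a) (Fin b) ℝ) (K : Fin a → Fin b → ℝ → ℝ)
    (f : ℝ → Fin b → ℝ) (t : ℝ) (i : Fin a) :
    (causalOp C K f t i : ℂ) = ∑ j, (C i j * f t j +
      conv (fun t => (f t j : ℂ)) (fun t => (K i j t : ℂ)) t) := by
  simp [causalOp, conv, ← intervalIntegral.integral_ofReal]

theorem transformable_sum_and_lap_sum {ι : Type*} (S : Finset ι) {f : ι → ℝ → ℂ}
    (hf : ∀ i, Transformable (f i)) : Transformable (fun t => ∑ i ∈ S, f i t) ∧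
      ∀ᶠ s in rightHalfPlanes, lap (fun t => ∑ i ∈ S, f i t) s = ∑ i ∈ S, lap (f i) s := by
  classical
  induction S using Finset.induction_on with
  | empty => simp [transformable_zero, lap]
  | insert a S ha ih =>
    simp only [Finset.sum_insert ha]
    refine ⟨(hf a).add ih.1, ?_⟩
    filter_upwards [ih.2, lap_add (hf a) ih.1] with s h1 h2
    rw [h2, h1]

theorem IsImpulseResponse.causalOp {a b : ℕ} {R : Matrix (Fin a) (Fin b) (RatFunc ℝ)}
    {C : Matrix (Fin a) (Fin b) ℝ} {K : Fin a → Fin b → ℝ → ℝ} (h : IsImpulseResponse R C K)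
    {f : ℝ → Fin b → ℝ} (hf : LaplaceTransformable f) :
    LaplaceTransformable (causalOp C K f) ∧
    ∀ᶠ s in rightHalfPlanes, laplace (causalOp C K f) s = evalMat s R *ᵥ laplace f s := by
  have hf' := laplaceTransformable_iff.1 hf
  have hc := fun i j => transformable_conv_and_lap_conv (hf' j) (h.transformable i j)
  have hterm : ∀ i j, Transformable (fun t => (C i j : ℂ) * f t j +
      conv (fun t => (f t j : ℂ)) (fun t => (K i j t : ℂ)) t) := fun i j =>
    ((hf' j).const_mul _).add (hc i j).1
  have hsum := fun i => transformable_sum_and_lap_sum Finset.univ (hterm i)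
  have hadd := fun i j => lap_add ((hf' j).const_mul (C i j : ℂ)) (hc i j).1
  constructor
  · rw [laplaceTransformable_iff]
    intro i
    simp only [ofReal_causalOp]
    exact (hsum i).1
  · filter_upwards [eventually_all.2 fun i => (hsum i).2,
      eventually_all.2 fun i => eventually_all.2 fun j => (hc i j).2,
      eventually_all.2 fun i => eventually_all.2 fun j => hadd i j,
      eventually_all.2 fun i => eventually_all.2 fun j => h.evalAt_eq i j] with s h1 h2 h3 h4
    ext i
    simp only [laplace_apply, ofReal_causalOp, h1, h3, h2, lap_const_mul, Matrix.mulVec,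
      dotProduct, evalMat, Matrix.map_apply, h4]
    exact Finset.sum_congr rfl fun j _ => by ring

/-- Continuity is asked of `C i j * f t j` rather than of `f`, so that for `C = 0` an arbitrary
transformable input is admitted. -/
theorem IsImpulseResponse.continuousOn_causalOp {a b : ℕ}
    {R : Matrix (Fin a) (Fin b) (RatFunc ℝ)} {C : Matrix (Fin a) (Fin b) ℝ}
    {K : Fin a → Fin b → ℝ → ℝ} (h : IsImpulseResponse R C K) {f : ℝ → Fin b → ℝ}
    (hf : LaplaceTransformable f) {J : Set ℝ} (hJ : J ⊆ Ici 0)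
    (hC : ∀ i j, ContinuousOn (fun t => C i j * f t j) J) :
    ContinuousOn (ILC.causalOp C K f) J := by
  refine continuousOn_pi.2 fun i => continuousOn_finsetSum _ fun j _ => (hC i j).add ?_
  have h1 := (continuousOn_conv (laplaceTransformable_iff.1 hf j)
    (Complex.continuous_ofReal.comp (h.continuous i j))).mono hJ
  refine (Complex.continuous_re.comp_continuousOn h1).congr fun t _ => ?_
  simp only [conv, Function.comp, ← Complex.ofReal_mul]
  rw [intervalIntegral.integral_ofReal, Complex.ofReal_re]

theorem causalOp_zero_zero {a b : ℕ} (K : Fin a → Fin b → ℝ → ℝ) (f : ℝ → Fin b → ℝ) :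
    causalOp 0 K f 0 = 0 := by
  ext i; simp [causalOp]

/-- Causality: the value at `t` involves the signal only on `[0, t]`, which lies in `J`. This makes
the choice of prolongation irrelevant on `J`. -/
theorem causalOp_ae_congr {a b : ℕ} (C : Matrix (Fin a) (Fin b) ℝ) (K : Fin a → Fin b → ℝ → ℝ)
    {f g : ℝ → Fin b → ℝ} {J : Set ℝ} (hJm : MeasurableSet J)
    (hJ : ∀ t ∈ J, 0 ≤ t ∧ Icc 0 t ⊆ J) (h : f =ᵐ[volume.restrict J] g) :
    causalOp C K f =ᵐ[volume.restrict J] causalOp C K g := by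
  filter_upwards [h, ae_restrict_mem hJm] with t ht htJ
  ext i
  refine Finset.sum_congr rfl fun j _ => ?_
  rw [ht]
  congr 1
  obtain ⟨h0, hsub⟩ := hJ t htJ
  refine intervalIntegral.integral_congr_ae ?_
  rw [uIoc_of_le h0]
  filter_upwards [(ae_restrict_iff' hJm).1 h] with x hx hxt
  rw [hx (hsub (Ioc_subset_Icc_self hxt))]

/-! ### The disturbance response. -/

/-- A strictly proper rational vector is the Laplace transform of a signal with a continuous
transformable derivative. -/
theorem exists_signal_of_strictlyProper {n : ℕ} {W : Fin n → RatFunc ℝ}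
    (hW : ∀ i, StrictlyProper (W i)) :
    ∃ (w₀ : Fin n → ℝ) (ω : ℝ → Fin n → ℝ), Continuous ω ∧ LaplaceTransformable ω ∧
      LaplaceTransformable (fun t => w₀ + primitive ω t) ∧
      ∀ᶠ s in rightHalfPlanes, laplace (fun t => w₀ + primitive ω t) s = evalVec s W := by
  have key : ∀ i, ∃ (c : ℝ) (k : ℝ → ℝ), Continuous k ∧ Transformable (fun t => (k t : ℂ)) ∧
      ∀ᶠ s in rightHalfPlanes, s⁻¹ * c + s⁻¹ * lap (fun t => (k t : ℂ)) s = evalAt s (W i) := by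
    intro i
    set N := (W i).num
    set D := (W i).denom
    have hD : D ≠ 0 := (W i).denom_ne_zero
    have hlt : N.degree < D.degree := (hW i).degree_lt
    set d := D.natDegree with hd
    have hdeg : D.degree = d := Polynomial.degree_eq_natDegree hD
    -- This is the limit of `s W i` at infinity, hence the initial value of the signal; the strictly
    -- proper remainder of `s W i` is the transform of the derivative.
    set c := (Polynomial.X * N).coeff d / D.leadingCoeff with hc
    have hlc : D.leadingCoeff ≠ 0 := Polynomial.leadingCoeff_ne_zero.2 hD
    have hlt' : (Polynomial.X * N - Polynomial.C c * D).degree < D.degree := by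
      rw [hdeg, Polynomial.degree_lt_iff_coeff_zero]
      intro m hm
      rcases hm.eq_or_lt with rfl | hm
      · rw [Polynomial.coeff_sub, Polynomial.coeff_C_mul, hc]
        have : D.coeff d = D.leadingCoeff := rfl
        rw [this]; field_simp; ring
      · obtain ⟨m, rfl⟩ : ∃ m', m = m' + 1 := ⟨m - 1, by omega⟩
        rw [Polynomial.coeff_sub, Polynomial.coeff_C_mul, Polynomial.coeff_X_mul,
          Polynomial.coeff_eq_zero_of_natDegree_lt (p := D) hm,
          Polynomial.coeff_eq_zero_of_degree_lt (p := N)]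
        · simp
        · refine hlt.trans_le ?_
          rw [hdeg]; exact_mod_cast Nat.lt_succ_iff.1 hm
    obtain ⟨k, hk, ht, hl⟩ := exists_lap_eq_div hD hlt'
    refine ⟨c, k, hk, ht, ?_⟩
    have h0 : ∀ᶠ s in rightHalfPlanes, s ≠ 0 :=
      rightHalfPlanes_le_cocompact ((finite_singleton (0 : ℂ)).isCompact.compl_mem_cocompact)
    filter_upwards [hl, h0, rightHalfPlanes_le_cocompact (eventually_denom_ne_zero (W i))]
      with s h1 h2 h3
    rw [h1, Polynomial.eval₂_sub, Polynomial.eval₂_mul, Polynomial.eval₂_mul,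
      Polynomial.eval₂_X, Polynomial.eval₂_C]
    change _ = N.eval₂ (algebraMap ℝ ℂ) s / D.eval₂ (algebraMap ℝ ℂ) s
    change D.eval₂ (algebraMap ℝ ℂ) s ≠ 0 at h3
    simp only [Complex.coe_algebraMap] at *
    field_simp
    ring
  choose w₀ k hk ht hl using key
  have hω : LaplaceTransformable (fun t i => k i t) := laplaceTransformable_iff.2 ht
  obtain ⟨hct, hcl⟩ := transformable_exp_and_lap_exp 0
  have hconst : LaplaceTransformable (fun _ : ℝ => w₀) := by
    rw [laplaceTransformable_iff]
    intro i
    simpa using hct.const_mul (w₀ i)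
  have hconstl : ∀ᶠ s in rightHalfPlanes, laplace (fun _ : ℝ => w₀) s
      = s⁻¹ • fun i => (w₀ i : ℂ) := by
    filter_upwards [hcl] with s hs
    ext i
    have := lap_const_mul (fun t : ℝ => Complex.exp (0 * t)) (w₀ i) s
    rw [hs] at this
    simpa [laplace_apply, mul_comm] using this
  refine ⟨w₀, fun t i => k i t, continuous_pi hk, hω, hconst.add hω.primitive, ?_⟩
  filter_upwards [laplace_add hconst hω.primitive, laplace_primitive hω, hconstl,
    eventually_all.2 hl] with s h1 h2 h3 h4
  rw [h1, h2, h3]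
  ext i
  simpa [laplace_apply, evalVec] using h4 i

/-! ### The left inverse of a transfer matrix of relative degree one. -/

theorem isUnit_transpose_mul_self {a b : ℕ} {M : Matrix (Fin a) (Fin b) ℝ} (h : M.rank = b) :
    IsUnit (Mᵀ * M) := by
  rw [← Matrix.rank_transpose_mul_self] at h
  rw [← Matrix.mulVec_surjective_iff_isUnit]
  have htop : LinearMap.range (Mᵀ * M).mulVecLin = ⊤ := by
    apply Submodule.eq_top_of_finrank_eq
    rw [Module.finrank_pi, Fintype.card_fin]
    exact h
  exact LinearMap.range_eq_top.1 htop

/-- For a tall transfer matrix of relative degree one, `(GᵀG)⁻¹Gᵀ` is `s` times a proper matrix,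
and `G (GᵀG)⁻¹Gᵀ` is proper. -/
theorem HasRelativeDegree.leftInverse {q p : ℕ} (hqp : p ≤ q)
    {G : Matrix (Fin q) (Fin p) (RatFunc ℝ)} (h : HasRelativeDegree G 1) :
    IsUnit (Gᵀ * G) ∧ ∃ (H : Matrix (Fin p) (Fin q) (RatFunc ℝ)) (C : Matrix (Fin p) (Fin q) ℝ)
      (E : Matrix (Fin q) (Fin q) ℝ), (Gᵀ * G)⁻¹ * Gᵀ = (RatFunc.X : RatFunc ℝ) • H ∧
      Tendsto (fun s => evalMat s H) (cocompact ℂ) (𝓝 (C.map (algebraMap ℝ ℂ))) ∧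
      Tendsto (fun s => evalMat s (G * ((RatFunc.X : RatFunc ℝ) • H))) (cocompact ℂ)
        (𝓝 (E.map (algebraMap ℝ ℂ))) := by
  obtain ⟨-, M, hM, hrank⟩ := h
  rw [min_eq_right hqp] at hrank
  have hMu := isUnit_transpose_mul_self hrank
  have hMdet : IsUnit (Mᵀ * M).det := (Matrix.isUnit_iff_isUnit_det _).1 hMu
  -- The rescaled matrix `B = s G` has limit `M` with `MᵀM` invertible. From `(GᵀG)⁻¹ = s² (BᵀB)⁻¹`
  -- one reads off `H = (BᵀB)⁻¹Bᵀ`, and the projection is `B H`.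
  set B : Matrix (Fin q) (Fin p) (RatFunc ℝ) := (RatFunc.X : RatFunc ℝ) • G with hB
  have hBlim : Tendsto (fun s => evalMat s B) (cocompact ℂ) (𝓝 (M.map (algebraMap ℝ ℂ))) := by
    refine hM.congr' ?_
    filter_upwards [evalMat_smul RatFunc.X G] with s hs
    rw [hs, evalAt_X, pow_one]
  have htr : Continuous fun N : Matrix (Fin q) (Fin p) ℂ => Nᵀ := Continuous.matrix_transpose
    continuous_id
  have hmul : ∀ {a b c : ℕ} {A : Matrix (Fin a) (Fin b) (RatFunc ℝ)}
      {A' : Matrix (Fin b) (Fin c) (RatFunc ℝ)} {L : Matrix (Fin a) (Fin b) ℝ}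
      {L' : Matrix (Fin b) (Fin c) ℝ},
      Tendsto (fun s => evalMat s A) (cocompact ℂ) (𝓝 (L.map (algebraMap ℝ ℂ))) →
      Tendsto (fun s => evalMat s A') (cocompact ℂ) (𝓝 (L'.map (algebraMap ℝ ℂ))) →
      Tendsto (fun s => evalMat s (A * A')) (cocompact ℂ)
        (𝓝 ((L * L').map (algebraMap ℝ ℂ))) := by
    intro a b c A A' L L' h1 h2
    rw [Matrix.map_mul]
    have hc : Continuous fun z : Matrix (Fin a) (Fin b) ℂ × Matrix (Fin b) (Fin c) ℂ =>
        z.1 * z.2 := continuous_fst.matrix_mul continuous_snd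
    refine ((hc.tendsto _).comp (h1.prodMk_nhds h2)).congr' ?_
    filter_upwards [evalMat_mul A A'] with s hs
    rw [hs]; rfl
  have hBt : Tendsto (fun s => evalMat s Bᵀ) (cocompact ℂ) (𝓝 (Mᵀ.map (algebraMap ℝ ℂ))) :=
    (htr.tendsto _).comp hBlim
  have hdet : ((Mᵀ * M).map (algebraMap ℝ ℂ)).det ≠ 0 := by
    have := RingHom.map_det (algebraMap ℝ ℂ) (Mᵀ * M)
    rw [RingHom.mapMatrix_apply] at this
    rw [← this]
    exact (map_ne_zero _).2 hMdet.ne_zero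
  obtain ⟨hu, hinv⟩ := isUnit_and_tendsto_inv (hmul hBt hBlim) hdet
  have hinvmap : ((Mᵀ * M).map (algebraMap ℝ ℂ))⁻¹ = (Mᵀ * M)⁻¹.map (algebraMap ℝ ℂ) := by
    refine Matrix.inv_eq_right_inv ?_
    rw [← Matrix.map_mul, Matrix.mul_nonsing_inv _ hMdet]
    exact Matrix.map_one _ (map_zero _) (map_one _)
  rw [hinvmap] at hinv
  have hBB : Bᵀ * B = (RatFunc.X * RatFunc.X : RatFunc ℝ) • (Gᵀ * G) := by
    simp only [hB, Matrix.transpose_smul, Matrix.smul_mul, Matrix.mul_smul, smul_smul]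
  have hprod : (Gᵀ * G) * ((RatFunc.X * RatFunc.X : RatFunc ℝ) • (Bᵀ * B)⁻¹) = 1 := by
    rw [Matrix.mul_smul, ← Matrix.smul_mul, ← hBB,
      Matrix.mul_nonsing_inv _ ((Matrix.isUnit_iff_isUnit_det _).1 hu)]
  refine ⟨IsUnit.of_mul_eq_one _ hprod, (Bᵀ * B)⁻¹ * Bᵀ, (Mᵀ * M)⁻¹ * Mᵀ,
    M * ((Mᵀ * M)⁻¹ * Mᵀ), ?_, hmul hinv hBt, ?_⟩
  · rw [Matrix.inv_eq_right_inv hprod]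
    generalize (Bᵀ * B)⁻¹ = Z
    simp only [hB, Matrix.transpose_smul, Matrix.smul_mul, Matrix.mul_smul, smul_smul]
  · have := hmul hBlim (hmul hinv hBt)
    rw [Matrix.mul_smul, ← Matrix.smul_mul]
    exact this

/-! ### Time horizons, initial values and primitives on them. -/

/-- The properties of the time horizons `[0, T]` and `[0, ∞)` that matter below. -/
structure IsHorizon (J : Set ℝ) : Prop where
  measurableSet : MeasurableSet J
  zero_mem : (0 : ℝ) ∈ J
  subset_Ici : J ⊆ Ici 0
  Icc_subset : ∀ t ∈ J, Icc 0 t ⊆ J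
  subset_closure : J ⊆ closure (interior J)
  uniqueDiffOn : UniqueDiffOn ℝ J
  exists_seq : ∃ b : ℕ → ℝ, (∀ n, b n ∈ J) ∧ ∀ t ∈ J, ∃ n, t ≤ b n

theorem isHorizon_Icc {T : ℝ} (hT : 0 < T) : IsHorizon (Icc 0 T) where
  measurableSet := measurableSet_Icc
  zero_mem := ⟨le_rfl, hT.le⟩
  subset_Ici := fun _ h => h.1
  Icc_subset := fun _ h => Icc_subset_Icc_right h.2
  subset_closure := by rw [closure_interior_Icc hT.ne]
  uniqueDiffOn := uniqueDiffOn_Icc hT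
  exists_seq := ⟨fun _ => T, fun _ => ⟨hT.le, le_rfl⟩, fun _ h => ⟨0, h.2⟩⟩

theorem isHorizon_Ici : IsHorizon (Ici 0) where
  measurableSet := measurableSet_Ici
  zero_mem := self_mem_Ici
  subset_Ici := subset_rfl
  Icc_subset := fun _ _ => Icc_subset_Ici_self
  subset_closure := by rw [interior_Ici, closure_Ioi]
  uniqueDiffOn := uniqueDiffOn_Ici 0
  exists_seq := ⟨fun n => n, fun n => mem_Ici.2 n.cast_nonneg, fun t _ => exists_nat_ge t⟩

variable {J : Set ℝ}

theorem IsHorizon.ae_restrict (hJ : IsHorizon J) {P : ℝ → Prop}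
    (h : ∀ᵐ t ∂(volume.restrict (Ioi (0 : ℝ))), P t) : ∀ᵐ t ∂(volume.restrict J), P t := by
  rw [Measure.restrict_congr_set Ioi_ae_eq_Ici] at h
  exact ae_restrict_of_ae_restrict_of_subset hJ.subset_Ici h

theorem IsHorizon.eqOn (hJ : IsHorizon J) {n : ℕ} {f g : ℝ → Fin n → ℝ}
    (h : f =ᵐ[volume.restrict J] g) (hf : ContinuousOn f J) (hg : ContinuousOn g J) :
    EqOn f g J :=
  Measure.eqOn_of_ae_eq h hf hg hJ.subset_closure

theorem IsHorizon.nonneg_and_Icc_subset (hJ : IsHorizon J) :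
    ∀ t ∈ J, 0 ≤ t ∧ Icc 0 t ⊆ J := fun t ht => ⟨hJ.subset_Ici ht, hJ.Icc_subset t ht⟩

theorem LaplaceTransformable.indicator {n : ℕ} {f : ℝ → Fin n → ℝ}
    (hf : LaplaceTransformable f) (hJ : MeasurableSet J) :
    LaplaceTransformable (J.indicator f) := by
  obtain ⟨σ, hσ⟩ := hf
  refine ⟨σ, (Integrable.indicator hσ hJ).congr (Eventually.of_forall fun t => ?_)⟩
  by_cases ht : t ∈ J <;> simp [ht]

theorem laplaceTransformable_indicator_Icc {n : ℕ} {f : ℝ → Fin n → ℝ} {T : ℝ}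
    (hf : ContinuousOn f (Icc 0 T)) : LaplaceTransformable ((Icc 0 T).indicator f) := by
  refine ⟨0, ?_⟩
  simp only [neg_zero, zero_mul, Real.exp_zero, one_smul]
  exact ((integrable_indicator_iff measurableSet_Icc).2 hf.integrableOn_Icc).integrableOn

/-- Two inputs with the same primitive on the horizon agree there almost everywhere. -/
theorem IsHorizon.ae_eq_of_primitive_eq (hJ : IsHorizon J) {n : ℕ} {f g : ℝ → Fin n → ℝ}
    (hf : LaplaceTransformable f) (hg : LaplaceTransformable g)
    (h : EqOn (primitive f) (primitive g) J) : f =ᵐ[volume.restrict J] g := by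
  have hi : ∀ i, ∀ᵐ t ∂(volume.restrict J), f t i - g t i = 0 := by
    intro i
    have hloc : ∀ t ∈ J, ∫ x in (0 : ℝ)..t, (f x i - g x i) = 0 := by
      intro t ht
      rw [intervalIntegral.integral_sub (hf.intervalIntegrable i (hJ.subset_Ici ht))
        (hg.intervalIntegrable i (hJ.subset_Ici ht)), sub_eq_zero]
      exact congrFun (h ht) i
    have hint : ∀ b ∈ J, IntervalIntegrable (fun x => f x i - g x i) volume 0 b := fun b hb =>
      (hf.intervalIntegrable i (hJ.subset_Ici hb)).sub (hg.intervalIntegrable i (hJ.subset_Ici hb))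
    obtain ⟨b, hb, hcover⟩ := hJ.exists_seq
    have hderiv := ae_all_iff.2 fun n => (hint (b n) (hb n)).ae_hasDerivAt_integral
    -- Off these countably many points, `x` is interior to some `[0, b n]`, where the integral of
    -- the difference vanishes on a whole neighbourhood.
    have hnull : ∀ᵐ x : ℝ, x ∉ insert 0 (range b) :=
      ((countable_range b).insert 0).ae_notMem volume
    refine (ae_restrict_iff' hJ.measurableSet).2 ?_
    filter_upwards [hderiv, hnull] with x hx hx0 hxJ
    obtain ⟨n, hn⟩ := hcover x hxJ
    have h0x : 0 ≤ x := hJ.subset_Ici hxJ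
    have hpos : 0 < x := h0x.lt_of_ne fun h => hx0 (Or.inl h.symm)
    have hlt : x < b n := hn.lt_of_ne fun h => hx0 (Or.inr ⟨n, h.symm⟩)
    have hmem : x ∈ uIcc 0 (b n) := by
      rw [uIcc_of_le (h0x.trans hn)]; exact ⟨h0x, hn⟩
    refine (hx n hmem 0 left_mem_uIcc).unique ((hasDerivAt_const x (0 : ℝ)).congr_of_eventuallyEq ?_)
    filter_upwards [Icc_mem_nhds hpos hlt] with t ht
    exact hloc t (hJ.Icc_subset _ (hb n) ht)
  filter_upwards [ae_all_iff.2 hi] with t ht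
  exact funext fun i => sub_eq_zero.1 (ht i)

/-- A continuous output starts at the initial value of the disturbance response. -/
theorem IsHorizon.output_zero_eq (hJ : IsHorizon J) {q p : ℕ}
    {G : Matrix (Fin q) (Fin p) (RatFunc ℝ)} (hG : ∀ i j, StrictlyProper (G i j))
    {W : Fin q → RatFunc ℝ} {w : ℝ → Fin q → ℝ} (hw : LaplaceTransformable w)
    (hwl : ∀ᶠ s in rightHalfPlanes, laplace w s = evalVec s W) (hwc : ContinuousOn w J)
    {U : ℝ → Fin p → ℝ} {y Y : ℝ → Fin q → ℝ} (hU : LaplaceTransformable U)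
    (hY : IsProlongation J y Y) (hy : ContinuousOn y J)
    (h : ∀ᶠ s in rightHalfPlanes, laplace Y s = evalMat s G *ᵥ laplace U s + evalVec s W) :
    y 0 = w 0 := by
  -- Strict properness means no feedthrough: the response to `U` is continuous and zero at time 0,
  -- so only `w` contributes there.
  obtain ⟨K, hK⟩ := exists_isImpulseResponse (R := G) (C := 0) (by
    rw [Matrix.map_zero _ (map_zero _)]
    exact tendsto_pi_nhds.2 fun i => tendsto_pi_nhds.2 fun j => hG i j)
  obtain ⟨hT, hl⟩ := hK.causalOp hU
  have hae : Y =ᵐ[volume.restrict (Ioi 0)] fun t => causalOp 0 K U t + w t := by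
    refine ae_eq_of_laplace_eq hY.1 (hT.add hw) ?_
    filter_upwards [h, hl, hwl, laplace_add hT hw] with s h1 h2 h3 h4
    rw [h4, h1, h2, h3]
  have haeJ : y =ᵐ[volume.restrict J] fun t => causalOp 0 K U t + w t := by
    filter_upwards [hJ.ae_restrict hae, ae_restrict_mem hJ.measurableSet] with t ht htJ
    rw [← hY.2 htJ, ht]
  have hc := hK.continuousOn_causalOp hU hJ.subset_Ici (by simpa using fun _ _ => continuousOn_const)
  have := hJ.eqOn haeJ hy (hc.add hwc) hJ.zero_mem
  simpa [causalOp_zero_zero] using this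

/-- The primitive of `f' - ω` recovers `f` minus the primitive of `ω`. -/
theorem IsHorizon.primitive_indicator_derivWithin (hJ : IsHorizon J) {n : ℕ}
    {f ω : ℝ → Fin n → ℝ} (hf : ContDiffOn ℝ 1 f J) (hω : Continuous ω) {t : ℝ} (ht : t ∈ J) :
    primitive (fun t => J.indicator (derivWithin f J) t - J.indicator ω t) t =
      f t - (f 0 + primitive ω t) := by
  have ht0 : 0 ≤ t := hJ.subset_Ici ht
  have hsub := hJ.Icc_subset t ht
  have hd : ContinuousOn (derivWithin f J) J :=
    hf.continuousOn_derivWithin hJ.uniqueDiffOn le_rfl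
  ext i
  have hdi : ContinuousOn (fun x => derivWithin f J x i) (Icc 0 t) :=
    (continuousOn_pi.1 hd i).mono hsub
  have hftc : ∫ x in (0 : ℝ)..t, derivWithin f J x i = f t i - f 0 i := by
    refine intervalIntegral.integral_eq_sub_of_hasDerivAt_of_le ht0
      (f := fun x => f x i) ((continuousOn_pi.1 hf.continuousOn i).mono hsub) (fun x hx => ?_)
      (hdi.intervalIntegrable_of_Icc ht0)
    have hx' : J ∈ 𝓝 x := mem_of_superset (Icc_mem_nhds hx.1 hx.2) hsub
    have := ((hf.differentiableOn one_ne_zero x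
      (mem_of_mem_nhds hx')).hasDerivWithinAt).hasDerivAt hx'
    exact hasDerivAt_pi.1 this i
  have hcongr : ∫ x in (0 : ℝ)..t, (J.indicator (derivWithin f J) x - J.indicator ω x) i
      = ∫ x in (0 : ℝ)..t, (derivWithin f J x i - ω x i) := by
    refine intervalIntegral.integral_congr fun x hx => ?_
    rw [uIcc_of_le ht0] at hx
    simp [hsub hx]
  have hωi : IntervalIntegrable (fun x => ω x i) volume 0 t :=
    ((continuous_apply i).comp hω).intervalIntegrable 0 t
  simp only [primitive, Pi.sub_apply, Pi.add_apply]
  refine hcongr.trans ?_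
  rw [intervalIntegral.integral_sub (hdi.intervalIntegrable_of_Icc ht0) hωi, hftc]
  ring

/-! ### The tracking input: existence and uniqueness. -/

section TrackingInput

variable {q p : ℕ} {G : Matrix (Fin q) (Fin p) (RatFunc ℝ)}
  {H : Matrix (Fin p) (Fin q) (RatFunc ℝ)} {C : Matrix (Fin p) (Fin q) ℝ}
  {E : Matrix (Fin q) (Fin q) ℝ} {K : Fin p → Fin q → ℝ → ℝ} {L : Fin q → Fin q → ℝ → ℝ}
  {W : Fin q → RatFunc ℝ} {w v yd : ℝ → Fin q → ℝ}

theorem eventually_ne_zero : ∀ᶠ s in rightHalfPlanes, s ≠ 0 :=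
  rightHalfPlanes_le_cocompact ((finite_singleton (0 : ℂ)).isCompact.compl_mem_cocompact)

/-- The given `Y` need not fit the input, as `∫v` matches `Y - w` only on `J`. The output actually
produced is `w + P ∫v` with `P` the projection; `P` fixes `Y - w`, so by causality this output
equals `yd` almost everywhere on `J`. -/
theorem IsHorizon.exists_prolongation_causalOp (hJ : IsHorizon J) (hK : IsImpulseResponse H C K)
    (hL : IsImpulseResponse (G * ((RatFunc.X : RatFunc ℝ) • H)) E L)
    (hw : LaplaceTransformable w) (hwl : ∀ᶠ s in rightHalfPlanes, laplace w s = evalVec s W)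
    (hv : LaplaceTransformable v) (hz : ∀ t ∈ J, primitive v t = yd t - w t)
    {Y : ℝ → Fin q → ℝ} (hY : IsProlongation J yd Y)
    (hproj : ∀ᶠ s in rightHalfPlanes, evalMat s (G * ((RatFunc.X : RatFunc ℝ) • H)) *ᵥ
      (laplace Y s - evalVec s W) = laplace Y s - evalVec s W) :
    ∃ Y', IsProlongation J yd Y' ∧ ∀ᶠ s in rightHalfPlanes,
      evalMat s G *ᵥ laplace (causalOp C K v) s = laplace Y' s - evalVec s W := by
  classical
  obtain ⟨hT₁, hl₁⟩ := hL.causalOp (hY.1.sub hw)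
  obtain ⟨hT₂, hl₂⟩ := hL.causalOp hv.primitive
  obtain ⟨hT₃, hl₃⟩ := hK.causalOp hv
  have h1 : (fun t => Y t - w t) =ᵐ[volume.restrict (Ioi 0)]
      causalOp E L (fun t => Y t - w t) := by
    refine ae_eq_of_laplace_eq (hY.1.sub hw) hT₁ ?_
    filter_upwards [hl₁, hproj, laplace_sub hY.1 hw, hwl] with s a1 a2 a3 a4
    rw [a1, a3, a4, a2]
  have h2 : primitive v =ᵐ[volume.restrict J] fun t => Y t - w t := by
    filter_upwards [ae_restrict_mem hJ.measurableSet] with t ht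
    rw [hz t ht, hY.2 ht]
  have h3 := causalOp_ae_congr E L hJ.measurableSet hJ.nonneg_and_Icc_subset h2
  -- A prolongation must agree with `yd` at every point of `J`; the correction on a null set leaves
  -- the transform unchanged.
  have h4 : (fun t => causalOp E L (primitive v) t + w t) =ᵐ[volume.restrict (Ioi 0)]
      J.piecewise yd (fun t => causalOp E L (primitive v) t + w t) := by
    have h5 : ∀ᵐ t ∂(volume.restrict J), causalOp E L (primitive v) t + w t = yd t := by
      filter_upwards [h3, hJ.ae_restrict h1, ae_restrict_mem hJ.measurableSet] with t a1 a2 a3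
      rw [a1, ← a2, hY.2 a3]; abel
    refine ae_restrict_of_ae ?_
    filter_upwards [(ae_restrict_iff' hJ.measurableSet).1 h5] with t ht
    by_cases htJ : t ∈ J
    · rw [piecewise_eq_of_mem _ _ _ htJ, ht htJ]
    · rw [piecewise_eq_of_notMem _ _ _ htJ]
  refine ⟨_, ⟨(hT₂.add hw).congr h4, piecewise_eqOn _ _ _⟩, ?_⟩
  rw [← laplace_congr h4]
  filter_upwards [laplace_add hT₂ hw, hl₂, hl₃, hwl, laplace_primitive hv,
    rightHalfPlanes_le_cocompact (evalMat_mul G ((RatFunc.X : RatFunc ℝ) • H)),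
    rightHalfPlanes_le_cocompact (evalMat_smul RatFunc.X H), eventually_ne_zero]
    with s a1 a2 a3 a4 a5 a6 a7 a8
  rw [a1, a2, a3, a4, a5, a6, a7, evalAt_X, add_sub_cancel_right, Matrix.mul_smul,
    Matrix.smul_mulVec, Matrix.mulVec_smul, smul_smul, mul_inv_cancel₀ a8, one_smul,
    Matrix.mulVec_mulVec]

/-- Dividing the input formula by `s` gives `∫U = H (Y - w)`, a proper relation. On `J` the right
side is `H ∫v = ∫ H v` by causality, so `U` and `H v` have equal primitives there. -/
theorem IsHorizon.ae_eq_causalOp (hJ : IsHorizon J) (hK : IsImpulseResponse H C K)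
    (hw : LaplaceTransformable w) (hwl : ∀ᶠ s in rightHalfPlanes, laplace w s = evalVec s W)
    (hv : LaplaceTransformable v) (hz : ∀ t ∈ J, primitive v t = yd t - w t)
    {Y : ℝ → Fin q → ℝ} {U : ℝ → Fin p → ℝ} (hY : IsProlongation J yd Y)
    (hU : LaplaceTransformable U)
    (h : ∀ᶠ s in rightHalfPlanes, laplace U s =
      evalMat s ((RatFunc.X : RatFunc ℝ) • H) *ᵥ (laplace Y s - evalVec s W)) :
    U =ᵐ[volume.restrict J] causalOp C K v := by
  obtain ⟨hT₁, hl₁⟩ := hK.causalOp (hY.1.sub hw)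
  obtain ⟨hT₂, hl₂⟩ := hK.causalOp hv.primitive
  obtain ⟨hT₃, hl₃⟩ := hK.causalOp hv
  have h1 : primitive U =ᵐ[volume.restrict (Ioi 0)] causalOp C K (fun t => Y t - w t) := by
    refine ae_eq_of_laplace_eq hU.primitive hT₁ ?_
    filter_upwards [laplace_primitive hU, h, hl₁, laplace_sub hY.1 hw, hwl, eventually_ne_zero,
      rightHalfPlanes_le_cocompact (evalMat_smul RatFunc.X H)] with s a1 a2 a3 a4 a5 a6 a7
    rw [a1, a2, a3, a4, a5, a7, evalAt_X, Matrix.smul_mulVec, smul_smul, inv_mul_cancel₀ a6,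
      one_smul]
  have h2 : primitive (causalOp C K v) =ᵐ[volume.restrict (Ioi 0)]
      causalOp C K (primitive v) := by
    refine ae_eq_of_laplace_eq hT₃.primitive hT₂ ?_
    filter_upwards [laplace_primitive hT₃, hl₂, hl₃, laplace_primitive hv] with s a1 a2 a3 a4
    rw [a1, a2, a3, a4, Matrix.mulVec_smul]
  have h3 : (fun t => Y t - w t) =ᵐ[volume.restrict J] primitive v := by
    filter_upwards [ae_restrict_mem hJ.measurableSet] with t ht
    rw [hz t ht, hY.2 ht]
  have h4 := causalOp_ae_congr C K hJ.measurableSet hJ.nonneg_and_Icc_subset h3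
  refine hJ.ae_eq_of_primitive_eq hU hT₃ (hJ.eqOn ?_
    ((continuousOn_primitive hU).mono hJ.subset_Ici)
    ((continuousOn_primitive hT₃).mono hJ.subset_Ici))
  have h5 : primitive U =ᵐ[volume.restrict J] causalOp C K (fun t => Y t - w t) :=
    hJ.ae_restrict h1
  have h6 : primitive (causalOp C K v) =ᵐ[volume.restrict J] causalOp C K (primitive v) :=
    hJ.ae_restrict h2
  exact (h5.trans h4).trans h6.symm

end TrackingInput

end

end ILC

/-! ### Proof of the theorem. -/

namespace ILC

theorem strictlyProper_mulVec {a b : ℕ} {G : Matrix (Fin a) (Fin b) (RatFunc ℝ)}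
    (hG : ∀ i j, StrictlyProper (G i j)) {D D' : Fin b → RatFunc ℝ} {d₀ : Fin b → ℝ}
    (hD' : ∀ i, StrictlyProper (D' i)) (hD : ∀ i, D i = RatFunc.C (d₀ i) + D' i) (i : Fin a) :
    StrictlyProper ((G *ᵥ D) i) := by
  have hDlim : ∀ j, Tendsto (fun s => evalAt s (D j)) (cocompact ℂ) (𝓝 (d₀ j : ℂ)) := by
    intro j
    have h1 := (hD' j).const_add (d₀ j : ℂ)
    rw [add_zero] at h1
    refine h1.congr' ?_
    filter_upwards [evalAt_add (RatFunc.C (d₀ j)) (D' j)] with s hs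
    rw [hD, hs, evalAt_C]
  have h : Tendsto (fun s => ∑ j, evalAt s (G i j) * evalAt s (D j)) (cocompact ℂ) (𝓝 0) := by
    have := tendsto_finsetSum Finset.univ fun j _ => (hG i j).mul (hDlim j)
    simpa using this
  refine h.congr' ?_
  filter_upwards [evalVec_mulVec G D] with s hs
  exact (congrFun hs i).symm

end ILC

theorem theorem1 {q p m : ℕ} (hqp : p ≤ q)
    (G₁ : Matrix (Fin q) (Fin p) (RatFunc ℝ)) (G₂ : Matrix (Fin q) (Fin m) (RatFunc ℝ))
    (D : Fin m → RatFunc ℝ)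
    (hG₁ : ∀ i j, ILC.StrictlyProper (G₁ i j)) (hG₂ : ∀ i j, ILC.StrictlyProper (G₂ i j))
    (hD : ∃ (d₀ : Fin m → ℝ) (D' : Fin m → RatFunc ℝ), d₀ ≠ 0 ∧
      (∀ i, ILC.StrictlyProper (D' i)) ∧ ∀ i, D i = RatFunc.C (d₀ i) + D' i)
    (hrel : ILC.HasRelativeDegree G₁ 1)
    (J : Set ℝ) (yd : ℝ → Fin q → ℝ) (hyd : ContDiffOn ℝ 1 yd J)
    (hJ : (∃ T : ℝ, 0 < T ∧ J = Icc 0 T) ∨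
      (J = Ici 0 ∧ ILC.LaplaceTransformable (derivWithin yd (Ici 0))))
    (u : ℕ → ℝ → Fin p → ℝ) (y : ℕ → ℝ → Fin q → ℝ)
    (hsys : ∀ k, ILC.IsOutput G₁ G₂ D J (u k) (y k)) (hy : ∀ k, ContinuousOn (y k) J) :
    IsUnit (G₁ᵀ * G₁) ∧
    (ILC.Trackable G₁ G₂ D J yd ↔
      (∀ k, yd 0 = y k 0) ∧ ∃ Y, ILC.IsProlongation J yd Y ∧ ILC.ProjectionEq G₁ G₂ D Y) ∧
    (ILC.Trackable G₁ G₂ D J yd →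
      ∃ ud : ℝ → Fin p → ℝ, ContinuousOn ud J ∧
        (∃ Y U, ILC.IsProlongation J yd Y ∧ ILC.IsProlongation J ud U ∧
          ILC.SolvesTrackingEq G₁ G₂ D U Y) ∧
        ∀ Y U, ILC.IsProlongation J yd Y → ILC.LaplaceTransformable U →
          ILC.SolvesTrackingEq G₁ G₂ D U Y →
          ILC.InputFormula G₁ G₂ D U Y ∧ U =ᵐ[volume.restrict J] ud) := by
  open ILC in
  obtain ⟨d₀, D', -, hD', hDD'⟩ := hD
  obtain ⟨w₀, ω, hωc, hω, hw, hwl⟩ :=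
    exists_signal_of_strictlyProper (strictlyProper_mulVec hG₂ hD' hDD')
  set w : ℝ → Fin q → ℝ := fun t => w₀ + primitive ω t with hwdef
  have hw0 : w 0 = w₀ := by rw [hwdef]; simp [primitive_zero]
  have hhor : IsHorizon J := by
    rcases hJ with ⟨T, hT, rfl⟩ | ⟨rfl, -⟩
    · exact isHorizon_Icc hT
    · exact isHorizon_Ici
  have hdyd : LaplaceTransformable (J.indicator (derivWithin yd J)) := by
    rcases hJ with ⟨T, hT, rfl⟩ | ⟨rfl, h⟩
    · exact laplaceTransformable_indicator_Icc
        (hyd.continuousOn_derivWithin hhor.uniqueDiffOn le_rfl)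
    · exact h.indicator measurableSet_Ici
  have hwc : ContinuousOn w J :=
    continuousOn_const.add ((continuousOn_primitive hω).mono hhor.subset_Ici)
  obtain ⟨hunit, H, C, E, hH, hHlim, hElim⟩ := hrel.leftInverse hqp
  obtain ⟨K, hK⟩ := exists_isImpulseResponse hHlim
  obtain ⟨L, hL⟩ := exists_isImpulseResponse hElim
  -- On `J` this is the derivative of `yd - w`. The cut-off makes it transformable, since `yd` is
  -- controlled only on `J`.
  set v : ℝ → Fin q → ℝ :=
    fun t => J.indicator (derivWithin yd J) t - J.indicator ω t with hvdef
  have hv : LaplaceTransformable v := hdyd.sub (hω.indicator hhor.measurableSet)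
  have hvc : ContinuousOn v J := by
    refine ((hyd.continuousOn_derivWithin hhor.uniqueDiffOn le_rfl).sub
      hωc.continuousOn).congr fun t ht => ?_
    simp [hvdef, ht]
  have hz : yd 0 = w 0 → ∀ t ∈ J, primitive v t = yd t - w t := by
    intro h0 t ht
    rw [hvdef, hhor.primitive_indicator_derivWithin hyd hωc ht, h0, hw0]
  have hy0 : ∀ k, y k 0 = w 0 := by
    intro k
    obtain ⟨U, Y, hU, hY, h⟩ := hsys k
    exact hhor.output_zero_eq hG₁ hw hwl hwc hU.1 hY (hy k) h
  have hproj_iff : ∀ {Y : ℝ → Fin q → ℝ}, ProjectionEq G₁ G₂ D Y ↔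
      ∀ᶠ s in rightHalfPlanes, evalMat s (G₁ * ((RatFunc.X : RatFunc ℝ) • H)) *ᵥ
        (laplace Y s - evalVec s (G₂ *ᵥ D)) = laplace Y s - evalVec s (G₂ *ᵥ D) := by
    intro Y
    refine eventually_congr ?_
    filter_upwards [rightHalfPlanes_le_cocompact
      (evalMat_sub 1 (G₁ * ((RatFunc.X : RatFunc ℝ) • H)))] with s hs
    rw [Matrix.mul_assoc, hH, hs, evalMat_one, Matrix.sub_mulVec, Matrix.one_mulVec, sub_eq_zero,
      eq_comm]
  have hinput : ∀ {Y : ℝ → Fin q → ℝ} {U : ℝ → Fin p → ℝ}, SolvesTrackingEq G₁ G₂ D U Y →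
      InputFormula G₁ G₂ D U Y := by
    intro Y U h
    filter_upwards [h, rightHalfPlanes_le_cocompact (evalMat_mul ((G₁ᵀ * G₁)⁻¹ * G₁ᵀ) G₁)]
      with s h1 h2
    rw [Matrix.mul_assoc, Matrix.nonsing_inv_mul _ ((Matrix.isUnit_iff_isUnit_det _).1 hunit),
      evalMat_one] at h2
    rw [← h1, Matrix.mulVec_mulVec, ← h2, Matrix.one_mulVec]
  have hnec : Trackable G₁ G₂ D J yd →
      yd 0 = w 0 ∧ ∃ Y, IsProlongation J yd Y ∧ ProjectionEq G₁ G₂ D Y := by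
    rintro ⟨Y, U, hY, hU, h⟩
    -- Equation (1) says that `yd` is itself a continuous output, so it starts at `w 0` like every
    -- `y k`.
    refine ⟨hhor.output_zero_eq hG₁ hw hwl hwc hU hY hyd.continuousOn ?_, Y, hY, ?_⟩
    · filter_upwards [h] with s hs
      rw [hs, sub_add_cancel]
    · rw [hproj_iff]
      filter_upwards [h, hinput h, rightHalfPlanes_le_cocompact
        (evalMat_mul G₁ ((RatFunc.X : RatFunc ℝ) • H))] with s h1 h2 h3
      rw [hH] at h2
      rw [h3, ← Matrix.mulVec_mulVec, ← h2, h1]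
  have huT : LaplaceTransformable (causalOp C K v) := (hK.causalOp hv).1
  have hsuff : yd 0 = w 0 → (∃ Y, IsProlongation J yd Y ∧ ProjectionEq G₁ G₂ D Y) →
      ∃ Y, IsProlongation J yd Y ∧ SolvesTrackingEq G₁ G₂ D (causalOp C K v) Y := by
    rintro h0 ⟨Y, hY, hpr⟩
    exact hhor.exists_prolongation_causalOp hK hL hw hwl hv (hz h0) hY (hproj_iff.1 hpr)
  refine ⟨hunit, ⟨fun h => ?_, fun ⟨h0, hpr⟩ => ?_⟩, fun h => ?_⟩
  · obtain ⟨h0, hpr⟩ := hnec h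
    exact ⟨fun k => h0.trans (hy0 k).symm, hpr⟩
  -- A single trial, `k = 0`, already reveals the value `w 0`.
  · obtain ⟨Y, hY, hs⟩ := hsuff ((h0 0).trans (hy0 0)) hpr
    exact ⟨Y, _, hY, huT, hs⟩
  · obtain ⟨h0, hpr⟩ := hnec h
    obtain ⟨Y, hY, hs⟩ := hsuff h0 hpr
    refine ⟨causalOp C K v, ?_, ⟨Y, _, hY, ⟨huT, fun _ _ => rfl⟩, hs⟩, ?_⟩
    · exact hK.continuousOn_causalOp hv hhor.subset_Ici fun i j =>
        continuousOn_const.mul (continuousOn_pi.1 hvc j)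
    · intro Y' U' hY' hU' hs'
      refine ⟨hinput hs', hhor.ae_eq_causalOp hK hw hwl hv (hz h0) hY' hU' ?_⟩
      have := hinput hs'
      unfold InputFormula at this
      rw [hH] at this
      exact this
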